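/- Let $C$ be a graded $C^*$-algebra, that is, a $C^*$-algebra with a $*$-automorphism $\gamma$ satisfying $\gamma^2=\mathrm{id}$, regarded as a right Hilbert module over itself with $\langle a,b\rangle=a^*b$. A *self-adjoint multiplier* of $C$ is a closed, densely defined, right $C$-linear operator on $C$ which is self-adjoint and regular (i.e. $1+D^2$ has dense range). For $f\in C_0(\mathbb R)$ let $f(D)\in M(C)$ denote its functional calculus, the $*$-homomorphism $C_0(\mathbb R)\to M(C)$ that sends $(x\pm i)^{-1}$ to $(D\pm i)^{-1}$. An *essentially self-adjoint multiplier* is a densely defined right $C$-linear operator whose closure is a self-adjoint multiplier; its functional calculus, its resolvents and its cores are those of its closure. A *core* of $D$ is a dense right $C$-submodule $\mathcal C$ of the domain such that $D$ is the closure of $D|_{\mathcal C}$. For $N>0$ put $D_N=i_N(D)$, where $i_N(x)=x(1+N^{-2}x^2)^{-1}$. An operator $D$ is *odd* if $\gamma$ maps its domain into itself and $\gamma D\gamma=-D$. Let $D$ and $D'$ be odd, essentially self-adjoint multipliers of $C$ with *bounded commutator*, which means that there is a subspace $\mathcal C\subseteq C$ such that 1. $D+D'$, on the intersection of the domains of the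 closures of $D$ and $D'$, is essentially self-adjoint, and $\mathcal C$ is a common core of $D$, $D'$ and $D+D'$; 2. $\mathcal C$ is mapped into itself by $D_N$ and $D'_N$ for every $N>0$, and bijectively onto itself by $(D\pm i)^{-1}$ and $(D'\pm i)^{-1}$; 3. the graded commutator $[D,D']=DD'+D'D$, defined on $\mathcal C$, extends to a bounded operator on $C$. Then, in the norm of the multiplier algebra $M(C)$, $$\lim_{t\to\infty}\bigl\|e^{-t^{-2}(D+D')^2}-e^{-t^{-2}D^2}e^{-t^{-2}D'^2}\bigr\|=0$$ and $$\lim_{t\to\infty}\bigl\|t^{-1}(D+D')e^{-t^{-2}(D+D')^2}-\bigl(t^{-1}De^{-t^{-2}D^2}\bigr)e^{-t^{-2}D'^2}-e^{-t^{-2}D^2}\bigl(t^{-1}D'e^{-t^{-2}D'^2}\bigr)\bigr\|=0.$$ -/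

import Mathlib

open Filter Topology
open scoped MultiplierAlgebra ZeroAtInfty

namespace UnboundedMultiplier

variable {C : Type*} [NonUnitalCStarAlgebra C]

/-- The domain of `D` is a right `C`-submodule of `C` and `D` is right `C`-linear. -/
structure IsRightLinear (D : C →ₗ.[ℂ] C) : Prop where
  mul_mem : ∀ x ∈ D.domain, ∀ c : C, x * c ∈ D.domain
  map_mul : ∀ (x : D.domain) (c : C), D ⟨x * c, mul_mem x x.2 c⟩ = D x * c

/-- The domain of the adjoint `D*` of `D` with respect to the `C`-valued inner product
`⟨a, b⟩ = a* b` of the right Hilbert `C`-module `C`. -/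
def adjointDomain (D : C →ₗ.[ℂ] C) : Set C :=
  {x | ∃ y : C, ∀ z : D.domain, star (D z) * x = star (z : C) * y}

/-- Unbounded self-adjoint multipliers of `C`: closed densely defined right `C`-linear operators
in the right Hilbert `C`-module `C` that are self-adjoint and regular (`1 + D²` has dense
range). -/
structure IsSelfAdjointMultiplier (D : C →ₗ.[ℂ] C) : Prop where
  dense : Dense (D.domain : Set C)
  rightLinear : IsRightLinear D
  closed : D.IsClosed
  symmetric : ∀ x y : D.domain, star (D x) * (y : C) = star (x : C) * D y
  adjointDomain_subset : adjointDomain D ⊆ D.domain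
  regular : Dense {y : C | ∃ (x : D.domain) (h : D x ∈ D.domain), (x : C) + D ⟨D x, h⟩ = y}

/-- Essentially self-adjoint multipliers of `C`: densely defined right `C`-linear operators whose
closure is an unbounded self-adjoint multiplier. -/
structure IsEssSelfAdjointMultiplier (D : C →ₗ.[ℂ] C) : Prop where
  dense : Dense (D.domain : Set C)
  rightLinear : IsRightLinear D
  closable : D.IsClosable
  closure : IsSelfAdjointMultiplier D.closure

/-- `D` is odd for the grading automorphism `γ`: its domain is a graded subspace and
`γ D γ = -D`. -/
def IsOdd (γ : C ≃⋆ₐ[ℂ] C) (D : C →ₗ.[ℂ] C) : Prop :=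
  ∀ x : D.domain, ∃ h : γ x ∈ D.domain, γ (D ⟨γ x, h⟩) = -D x

/-- `𝒞` is a core of the closed operator `D`: a dense right `C`-submodule of the domain of `D`
such that `D` is the closure of its restriction to `𝒞`. -/
structure IsCore (D : C →ₗ.[ℂ] C) (𝒞 : Submodule ℂ C) : Prop where
  dense : Dense (𝒞 : Set C)
  mul_mem : ∀ x ∈ 𝒞, ∀ c : C, x * c ∈ 𝒞
  hasCore : D.HasCore 𝒞

/-- The bounded multiplier `R` is a two-sided inverse of `D + z`. -/
structure IsResolvent (D : C →ₗ.[ℂ] C) (z : ℂ) (R : 𝓜(ℂ, C)) : Prop where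
  right_inv : ∀ c : C, ∃ h : R.fst c ∈ D.domain, D ⟨R.fst c, h⟩ + z • R.fst c = c
  left_inv : ∀ x : D.domain, R.fst (D x + z • (x : C)) = x

theorem norm_le_norm_add_smul {D : C →ₗ.[ℂ] C} (hD : IsSelfAdjointMultiplier D) {z : ℂ}
    (hz : z = Complex.I ∨ z = -Complex.I) (x : D.domain) :
    ‖(x : C)‖ ≤ ‖D x + z • (x : C)‖ := by
  let _ := CStarAlgebra.spectralOrder C
  have _ := CStarAlgebra.spectralOrderedRing C
  have key : star (D x + z • (x : C)) * (D x + z • (x : C))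
      = star (D x) * D x + star (x : C) * x := by
    have hs := hD.symmetric x x
    rcases hz with rfl | rfl
    · simp only [star_add, star_smul, add_mul, mul_add, smul_mul_assoc, mul_smul_comm, smul_smul,
        hs, smul_add]
      simp
    · simp only [star_add, star_smul, add_mul, mul_add, smul_mul_assoc, mul_smul_comm, smul_smul,
        hs, smul_add]
      simp
  have h1 : ‖star (x : C) * x‖ ≤ ‖star (D x + z • (x : C)) * (D x + z • (x : C))‖ := by
    rw [key]
    exact CStarAlgebra.norm_le_norm_of_nonneg_of_le (star_mul_self_nonneg _)
      (le_add_of_nonneg_left (star_mul_self_nonneg _))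
  rw [CStarRing.norm_star_mul_self, CStarRing.norm_star_mul_self] at h1
  exact (mul_self_le_mul_self_iff (norm_nonneg _) (norm_nonneg _)).2 h1

theorem exists_add_smul_eq {D : C →ₗ.[ℂ] C} (hD : IsSelfAdjointMultiplier D) {z : ℂ}
    (hz : z = Complex.I ∨ z = -Complex.I) (c : C) : ∃ x : D.domain, D x + z • (x : C) = c := by
  have hz1 : ‖z‖ = 1 := by rcases hz with rfl | rfl <;> simp
  have hzz : z * z = -1 := by rcases hz with rfl | rfl <;> simp
  let L : D.graph →L[ℂ] C :=
    (ContinuousLinearMap.snd ℂ C C + z • ContinuousLinearMap.fst ℂ C C).comp D.graph.subtypeL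
  have hL : ∀ (x : D.domain), L ⟨((x : C), D x), D.mem_graph x⟩ = D x + z • (x : C) :=
    fun x => rfl
  have hcomplete : CompleteSpace D.graph := hD.closed.completeSpace_coe
  have hanti : AntilipschitzWith 2 L := by
    refine AddMonoidHomClass.antilipschitz_of_bound L ?_
    rintro ⟨⟨x, y⟩, hxy⟩
    obtain ⟨x', hx, hy⟩ := (D.mem_graph_iff).1 hxy
    dsimp only at hx hy
    subst hx hy
    rw [hL]
    have h1 := norm_le_norm_add_smul hD hz x'
    have h2 : ‖D x'‖ ≤ ‖D x' + z • (x' : C)‖ + ‖z • (x' : C)‖ := by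
      simpa using norm_sub_le (D x' + z • (x' : C)) (z • (x' : C))
    rw [norm_smul, hz1, one_mul] at h2
    refine max_le ?_ ?_
    · change ‖(x' : C)‖ ≤ 2 * ‖D x' + z • (x' : C)‖
      linarith [norm_nonneg (D x' + z • (x' : C))]
    · change ‖D x'‖ ≤ 2 * ‖D x' + z • (x' : C)‖
      linarith
  have hclosed : IsClosed (Set.range L) := hanti.isClosed_range L.uniformContinuous
  have hdense : Dense (Set.range L) := by
    refine hD.regular.mono ?_
    rintro y ⟨x, h, rfl⟩
    refine ⟨⟨(_, D (⟨D x, h⟩ - z • x)), D.mem_graph (⟨D x, h⟩ - z • x)⟩, ?_⟩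
    rw [hL]
    simp only [LinearPMap.map_sub, LinearPMap.map_smul, Submodule.coe_sub, Submodule.coe_smul,
      smul_sub, smul_smul, hzz]
    simp only [neg_smul, one_smul]
    abel
  have hc : c ∈ Set.range L := by
    rw [← hclosed.closure_eq]
    exact hdense c
  obtain ⟨⟨⟨x, y⟩, hxy⟩, rfl⟩ := hc
  obtain ⟨x', hx, hy⟩ := (D.mem_graph_iff).1 hxy
  dsimp only at hx hy
  subst hx hy
  exact ⟨x', rfl⟩

theorem exists_inverse {D : C →ₗ.[ℂ] C} (hD : IsSelfAdjointMultiplier D) {z : ℂ}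
    (hz : z = Complex.I ∨ z = -Complex.I) :
    ∃ T : C →L[ℂ] C, (∀ c : C, ∃ h : T c ∈ D.domain, D ⟨T c, h⟩ + z • T c = c) ∧
      ∀ x : D.domain, T (D x + z • (x : C)) = x := by
  have hinj : ∀ x y : D.domain, D x + z • (x : C) = D y + z • (y : C) → x = y := by
    intro x y hxy
    have h := norm_le_norm_add_smul hD hz (x - y)
    rw [LinearPMap.map_sub, Submodule.coe_sub, smul_sub, sub_add_sub_comm, hxy, sub_self,
      norm_zero] at h
    exact Subtype.ext (sub_eq_zero.1 (norm_le_zero_iff.1 h))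
  choose g hg using exists_add_smul_eq hD hz
  let T₀ : C →ₗ[ℂ] C :=
    { toFun := fun c => g c
      map_add' := by
        intro a b
        rw [← Submodule.coe_add]
        congr 1
        apply hinj
        rw [hg, LinearPMap.map_add, Submodule.coe_add, smul_add, add_add_add_comm, hg, hg]
      map_smul' := by
        intro r a
        rw [RingHom.id_apply, ← Submodule.coe_smul]
        congr 1
        apply hinj
        rw [hg, LinearPMap.map_smul, Submodule.coe_smul, smul_comm, ← smul_add, hg] }
  refine ⟨T₀.mkContinuous 1 ?_, ?_, ?_⟩
  · intro c
    have h := norm_le_norm_add_smul hD hz (g c)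
    rw [hg] at h
    simpa [T₀] using h
  · intro c
    exact ⟨(g c).2, hg c⟩
  · intro x
    exact congrArg Subtype.val (hinj _ _ (hg (D x + z • (x : C))))

theorem exists_isResolvent {D : C →ₗ.[ℂ] C} (hD : IsSelfAdjointMultiplier D) {z : ℂ}
    (hz : z = Complex.I ∨ z = -Complex.I) : ∃ R : 𝓜(ℂ, C), IsResolvent D z R := by
  have hz' : star z = Complex.I ∨ star z = -Complex.I := by
    rcases hz with rfl | rfl <;> simp
  obtain ⟨T, hT, hT'⟩ := exists_inverse hD hz
  obtain ⟨S, hS, -⟩ := exists_inverse hD hz'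
  let σ : C →L⋆[ℂ] C := ((starₗᵢ ℂ : C ≃ₗᵢ⋆[ℂ] C) : C →L⋆[ℂ] C)
  refine ⟨⟨(T, (σ.comp S).comp σ), ?_⟩, hT, hT'⟩
  intro x y
  change star (S (star x)) * y = x * T y
  obtain ⟨hu, hu'⟩ := hS (star x)
  obtain ⟨hv, hv'⟩ := hT y
  have hs := hD.symmetric ⟨_, hu⟩ ⟨_, hv⟩
  have hx : x = star (D ⟨_, hu⟩ + star z • S (star x)) := by rw [hu', star_star]
  conv_rhs => rw [hx]
  conv_lhs => rw [← hv']
  simp only [star_add, star_smul, star_star, add_mul, mul_add, smul_mul_assoc, mul_smul_comm]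
  rw [hs]

open Classical in
/-- The resolvent `(D + z)⁻¹` as an element of the multiplier algebra. For a self-adjoint
multiplier `D` and `z = ± i` it exists by `exists_isResolvent`, and it is unique. -/
noncomputable def resolvent (D : C →ₗ.[ℂ] C) (z : ℂ) : 𝓜(ℂ, C) :=
  if h : ∃ R : 𝓜(ℂ, C), IsResolvent D z R then h.choose else 0

theorem isResolvent_resolvent {D : C →ₗ.[ℂ] C} (hD : IsSelfAdjointMultiplier D) {z : ℂ}
    (hz : z = Complex.I ∨ z = -Complex.I) : IsResolvent D z (resolvent D z) := by
  have h := exists_isResolvent hD hz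
  rw [resolvent, dif_pos h]
  exact h.choose_spec

/-- The functional calculus `f(D)` of a self-adjoint multiplier `D`, for `f` continuous and
vanishing at infinity. It is the continuous functional calculus of the normal element
`(D + i)⁻¹` of the C⋆-algebra of multipliers; a point `w ≠ 0` of the spectrum of `(D + i)⁻¹` has
the form `(x + i)⁻¹` with `x = Re w⁻¹` real, and `w = 0` corresponds to `x = ∞`.
By `exists_starAlgHom_eq_funcCalc` this is the `*`-homomorphism `C₀(ℝ) → M(C)` that sends
`(x ± i)⁻¹` to `(D ± i)⁻¹`. -/
noncomputable def funcCalc (D : C →ₗ.[ℂ] C) (f : ℝ → ℂ) : 𝓜(ℂ, C) :=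
  cfc (fun w : ℂ => if w = 0 then 0 else f (w⁻¹).re) (resolvent D Complex.I)

theorem multiplier_ext {a b : 𝓜(ℂ, C)} (h : ∀ c, a.fst c = b.fst c) : a = b := by
  have hsnd : ∀ c, a.snd c = b.snd c := by
    intro c
    rw [← sub_eq_zero]
    have h0 : ∀ y, (a.snd c - b.snd c) * y = 0 := by
      intro y
      rw [sub_mul, a.central, b.central, h, sub_self]
    exact CStarRing.mul_star_self_eq_zero_iff _ |>.1 (h0 _)
  exact DoubleCentralizer.ext ℂ C _ _
    (Prod.ext (ContinuousLinearMap.ext h) (ContinuousLinearMap.ext hsnd))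

theorem star_resolvent {D : C →ₗ.[ℂ] C} (hD : IsSelfAdjointMultiplier D) :
    star (resolvent D Complex.I) = resolvent D (-Complex.I) := by
  have hp := isResolvent_resolvent hD (Or.inl rfl)
  have hm := isResolvent_resolvent hD (Or.inr rfl)
  refine multiplier_ext fun c => ?_
  rw [DoubleCentralizer.star_fst]
  obtain ⟨hu, hu'⟩ := hm.right_inv c
  set u := (resolvent D (-Complex.I)).fst c
  rw [star_eq_iff_star_eq, eq_comm, ← sub_eq_zero]
  have h0 : ∀ y, ((resolvent D Complex.I).snd (star c) - star u) * y = 0 := by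
    intro y
    obtain ⟨hv, hv'⟩ := hp.right_inv y
    have hs := hD.symmetric ⟨_, hu⟩ ⟨_, hv⟩
    rw [sub_mul, DoubleCentralizer.central]
    conv_lhs => enter [1]; rw [← hu']
    conv_lhs => enter [2]; rw [← hv']
    simp only [star_add, star_smul, add_mul, mul_add, smul_mul_assoc, mul_smul_comm]
    rw [hs]
    simp [u]
  exact CStarRing.mul_star_self_eq_zero_iff _ |>.1 (h0 _)

theorem resolvent_sub {D : C →ₗ.[ℂ] C} (hD : IsSelfAdjointMultiplier D) :
    resolvent D Complex.I - resolvent D (-Complex.I)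
        + (2 * Complex.I) • (resolvent D Complex.I * resolvent D (-Complex.I)) = 0 ∧
    resolvent D Complex.I - resolvent D (-Complex.I)
        + (2 * Complex.I) • (resolvent D (-Complex.I) * resolvent D Complex.I) = 0 := by
  have hp := isResolvent_resolvent hD (Or.inl rfl)
  have hm := isResolvent_resolvent hD (Or.inr rfl)
  constructor
  · refine multiplier_ext fun c => ?_
    obtain ⟨hu, hu'⟩ := hm.right_inv c
    have h := hp.left_inv ⟨_, hu⟩
    set u := (resolvent D (-Complex.I)).fst c with hudef
    have h2 : D ⟨u, hu⟩ + Complex.I • u = c + (2 * Complex.I) • u := by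
      rw [← hu']
      module
    rw [h2, map_add, map_smul] at h
    change (resolvent D Complex.I).fst c - u + (2 * Complex.I) • (resolvent D Complex.I).fst u = 0
    rw [← sub_eq_zero] at h
    rw [← h]
    abel
  · refine multiplier_ext fun c => ?_
    obtain ⟨hu, hu'⟩ := hp.right_inv c
    have h := hm.left_inv ⟨_, hu⟩
    set u := (resolvent D Complex.I).fst c with hudef
    have h2 : D ⟨u, hu⟩ + (-Complex.I) • u = c - (2 * Complex.I) • u := by
      rw [← hu']
      module
    rw [h2, map_sub, map_smul] at h
    change u - (resolvent D (-Complex.I)).fst c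
      + (2 * Complex.I) • (resolvent D (-Complex.I)).fst u = 0
    rw [← sub_eq_zero] at h
    rw [← neg_eq_zero, ← h]
    dsimp only
    abel

theorem isStarNormal_resolvent {D : C →ₗ.[ℂ] C} (hD : IsSelfAdjointMultiplier D) :
    IsStarNormal (resolvent D Complex.I) := by
  obtain ⟨h1, h2⟩ := resolvent_sub hD
  constructor
  rw [star_resolvent hD]
  have h3 := add_left_cancel (h2.trans h1.symm)
  exact smul_right_injective _ (r := 2 * Complex.I) (by simp) h3

theorem im_inv_of_mem_spectrum {D : C →ₗ.[ℂ] C} (hD : IsSelfAdjointMultiplier D) {w : ℂ}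
    (hw : w ∈ spectrum ℂ (resolvent D Complex.I)) (hw0 : w ≠ 0) : (w⁻¹).im = 1 := by
  have hn := isStarNormal_resolvent hD
  have h1 := (resolvent_sub hD).1
  rw [← star_resolvent hD] at h1
  have h2 : cfc (fun w : ℂ => w - star w + (2 * Complex.I) • (w * star w))
      (resolvent D Complex.I) = cfc (fun _ : ℂ => (0 : ℂ)) (resolvent D Complex.I) := by
    rw [cfc_add _ _ _ (by fun_prop) (by fun_prop), cfc_sub _ _ _ (by fun_prop) (by fun_prop),
      cfc_smul _ _ _ (by fun_prop), cfc_mul _ _ _ (by fun_prop) (by fun_prop), cfc_star (fun w : ℂ => w),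
      cfc_id' ℂ (resolvent D Complex.I), h1, cfc_const_zero]
  have h3 := (cfc_eq_cfc_iff_eqOn (ha := hn) (hf := by fun_prop) (hg := by fun_prop)).1 h2 hw
  have h4 := congrArg Complex.im h3
  have h5 : Complex.normSq w ≠ 0 := by simpa using hw0
  simp [Complex.normSq_apply] at h4 h5
  rw [Complex.inv_im, div_eq_one_iff_eq (by simpa using hw0), Complex.normSq_apply]
  linarith

theorem continuousOn_spectrum {D : C →ₗ.[ℂ] C} (hD : IsSelfAdjointMultiplier D) (f : C₀(ℝ, ℂ)) :
    ContinuousOn (fun w : ℂ => if w = 0 then 0 else f (w⁻¹).re)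
      (spectrum ℂ (resolvent D Complex.I)) := by
  intro w hw
  by_cases hw0 : w = 0
  · subst hw0
    rw [Metric.continuousWithinAt_iff]
    intro ε hε
    have h := (zero_at_infty f).eventually (Metric.ball_mem_nhds 0 hε)
    obtain ⟨M, hM⟩ := Metric.closedBall_compl_subset_of_mem_cocompact h (0 : ℝ)
    refine ⟨(|M| + 2)⁻¹, by positivity, ?_⟩
    intro v hv hvd
    by_cases hv0 : v = 0
    · simpa [hv0] using hε
    rw [dist_zero_right] at hvd
    have h1 : |M| + 2 < ‖v⁻¹‖ := by
      rw [norm_inv]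
      exact (lt_inv_comm₀ (norm_pos_iff.2 hv0) (by positivity)).1 hvd
    have h2 := Complex.norm_le_abs_re_add_abs_im v⁻¹
    rw [im_inv_of_mem_spectrum hD hv hv0, abs_one] at h2
    have h3 : (v⁻¹).re ∈ (Metric.closedBall (0 : ℝ) M)ᶜ := by
      simp only [Set.mem_compl_iff, Metric.mem_closedBall, dist_zero_right, Real.norm_eq_abs,
        not_le]
      linarith [le_abs_self M]
    have h4 := hM h3
    simpa [hv0] using h4
  · refine ContinuousAt.continuousWithinAt ?_
    have h : ContinuousAt (fun w : ℂ => f (w⁻¹).re) w :=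
      (f.continuous.comp Complex.continuous_re).continuousAt.comp (continuousAt_inv₀ hw0)
    refine h.congr ?_
    filter_upwards [isOpen_ne.mem_nhds hw0] with v hv
    rw [if_neg hv]

theorem exists_starAlgHom_eq_funcCalc {D : C →ₗ.[ℂ] C} (hD : IsSelfAdjointMultiplier D) :
    ∃ φ : C₀(ℝ, ℂ) →⋆ₙₐ[ℂ] 𝓜(ℂ, C), (∀ f, φ f = funcCalc D f) ∧
      (∀ f : C₀(ℝ, ℂ), (∀ x : ℝ, f x = (x + Complex.I)⁻¹) → φ f = resolvent D Complex.I) ∧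
      (∀ f : C₀(ℝ, ℂ), (∀ x : ℝ, f x = (x - Complex.I)⁻¹) → φ f = resolvent D (-Complex.I)) := by
  have hn := isStarNormal_resolvent hD
  have hc := continuousOn_spectrum hD
  have hre : ∀ w ∈ spectrum ℂ (resolvent D Complex.I), w ≠ 0 →
      (((w⁻¹).re : ℝ) : ℂ) + Complex.I = w⁻¹ := by
    intro w hw hw0
    apply Complex.ext <;> simp [-Complex.inv_re, -Complex.inv_im, im_inv_of_mem_spectrum hD hw hw0]
  refine ⟨{ toFun := fun f => funcCalc D f
            map_smul' := ?_
            map_zero' := ?_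
            map_add' := ?_
            map_mul' := ?_
            map_star' := ?_ }, fun f => rfl, ?_, ?_⟩
  · intro r f
    change cfc _ _ = r • cfc _ _
    rw [← cfc_smul _ _ _ (hc f)]
    congr 1
    funext w
    by_cases hw : w = 0 <;> simp [hw]
  · change cfc _ _ = 0
    rw [← cfc_const_zero ℂ (resolvent D Complex.I)]
    congr 1
    funext w
    by_cases hw : w = 0 <;> simp [hw]
  · intro f g
    change cfc _ _ = cfc _ _ + cfc _ _
    rw [← cfc_add _ _ _ (hc f) (hc g)]
    congr 1
    funext w
    by_cases hw : w = 0 <;> simp [hw]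
  · intro f g
    change cfc _ _ = cfc _ _ * cfc _ _
    rw [← cfc_mul _ _ _ (hc f) (hc g)]
    congr 1
    funext w
    by_cases hw : w = 0 <;> simp [hw]
  · intro f
    change cfc _ _ = star (cfc _ _)
    rw [← cfc_star]
    congr 1
    funext w
    by_cases hw : w = 0 <;> simp [hw]
  · intro f hf
    change cfc _ _ = _
    conv_rhs => rw [← cfc_id' ℂ (resolvent D Complex.I)]
    refine cfc_congr fun w hw => ?_
    by_cases hw0 : w = 0
    · simp [hw0]
    · simp only [hw0, if_false, hf]
      rw [hre w hw hw0, inv_inv]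
  · intro f hf
    change cfc _ _ = _
    rw [← star_resolvent hD]
    conv_rhs => rw [← cfc_id' ℂ (resolvent D Complex.I), ← cfc_star]
    refine cfc_congr fun w hw => ?_
    by_cases hw0 : w = 0
    · simp [hw0]
    · simp only [hw0, if_false, hf]
      have h := congrArg star (hre w hw hw0)
      rw [inv_eq_iff_eq_inv, ← star_inv₀, ← h]
      simp [sub_eq_add_neg]

/-- The bounded function `i_N(x) = x (1 + N⁻² x²)⁻¹`. -/
noncomputable def iFun (N : ℝ) : ℝ → ℂ := fun x => ((x * (1 + N⁻¹ ^ 2 * x ^ 2)⁻¹ : ℝ) : ℂ)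

/-- The function `x ↦ exp(-t⁻² x²)`. -/
noncomputable def gaussian (t : ℝ) : ℝ → ℂ := fun x => (Real.exp (-(t⁻¹ ^ 2 * x ^ 2)) : ℂ)

/-- The function `x ↦ t⁻¹ x exp(-t⁻² x²)`. -/
noncomputable def xGaussian (t : ℝ) : ℝ → ℂ :=
  fun x => (t⁻¹ * x * Real.exp (-(t⁻¹ ^ 2 * x ^ 2)) : ℝ)

/-- The closed operator `D + D'`, that is, the closure of the operator `x ↦ D x + D' x` with
domain `dom D ∩ dom D'`. -/
noncomputable def closedSum (D D' : C →ₗ.[ℂ] C) : C →ₗ.[ℂ] C := (D + D').closure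

/-- The bounded commutator conditions for self-adjoint multipliers `D`, `D'` with a given common
core `𝒞`. For odd `D` and `D'` the graded commutator is `[D, D'] = D D' + D' D`. -/
structure HasBoundedCommutatorOn (D D' : C →ₗ.[ℂ] C) (𝒞 : Submodule ℂ C) : Prop where
  sum_essSelfAdjoint : IsEssSelfAdjointMultiplier (D + D')
  core_left : IsCore D 𝒞
  core_right : IsCore D' 𝒞
  core_sum : IsCore (closedSum D D') 𝒞
  mapsTo_left : ∀ N : ℝ, 0 < N → Set.MapsTo (funcCalc D (iFun N)).fst 𝒞 𝒞
  mapsTo_right : ∀ N : ℝ, 0 < N → Set.MapsTo (funcCalc D' (iFun N)).fst 𝒞 𝒞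
  bijOn_left : ∀ z : ℂ, z = Complex.I ∨ z = -Complex.I →
    Set.BijOn (resolvent D z).fst 𝒞 𝒞
  bijOn_right : ∀ z : ℂ, z = Complex.I ∨ z = -Complex.I →
    Set.BijOn (resolvent D' z).fst 𝒞 𝒞
  commutator : ∃ T : C →L[ℂ] C, ∀ x ∈ 𝒞,
    ∃ (hx : x ∈ D.domain) (hx' : x ∈ D'.domain)
      (h : D' ⟨x, hx'⟩ ∈ D.domain) (h' : D ⟨x, hx⟩ ∈ D'.domain),
      D ⟨D' ⟨x, hx'⟩, h⟩ + D' ⟨D ⟨x, hx⟩, h'⟩ = T x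

/-- The essentially self-adjoint multipliers `D` and `D'` have bounded commutator. Essentially
self-adjoint multipliers are identified with their closures. -/
def HasBoundedCommutator (D D' : C →ₗ.[ℂ] C) : Prop :=
  ∃ 𝒞 : Submodule ℂ C, HasBoundedCommutatorOn D.closure D'.closure 𝒞

end UnboundedMultiplier

/-! For bounded self-adjoint `a`, `b` put `T = ab + ba`. Then `(a + b)² = a² + b² + T` and `a²b -
ba² = aT - Ta`, so if `T` is small the squares almost add up and `a²` almost commutes with `b`.
Interpolating between the two sides gives `‖e^{-(a+b)²} - e^{-a²}e^{-b²}‖ ≤ 100‖T‖` when `‖T‖ ≤ 1`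
(`norm_expNegSq_add_sub_le`), and a similar bound for `xe^{-x²}` (`norm_add_mul_expNegSq_sub_le`).
The constants do not depend on `‖a‖` and `‖b‖`: every loose factor `a` or `b` is absorbed by a
Gaussian.

These estimates are applied to `t⁻¹D_N` and `t⁻¹D'_N`. For odd operators the graded commutator is
the anticommutator, and a resolvent-type identity (`anticommutator_eq`), used once for `D` and once
for `D'`, bounds the anticommutator of `D_N` and `D'_N` by a constant `M` independent of `N`. After
rescaling it is at most `t⁻²M`.

Now let `N → ∞` with `t` fixed. On the common core `D_N`, `D'_N` and `D_N + D'_N` converge to `D`,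
`D'` and `D + D'`. Convergence on a core implies strong resolvent convergence, hence strong
convergence of the functional calculus (`tendsto_funcCalc`). Norm bounds survive strong limits, so
both expressions are `O(t⁻²)`. -/

namespace UnboundedMultiplier

/-! ### Gaussians of bounded self-adjoint elements with small anticommutator. -/

section Bounded

variable {A : Type*} [CStarAlgebra A]

/-- The Gaussian `exp(-a²)` of a bounded element `a`. -/
noncomputable def expNegSq (a : A) : A := NormedSpace.exp (-(a * a))

theorem cfc_gaussian_eq {a : A} (ha : IsSelfAdjoint a) :
    cfc (fun x : ℝ => Real.exp (-(x * x))) a = expNegSq a := by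
  have h1 : cfc (fun x : ℝ => -(x * x)) a = -(a * a) := by
    rw [cfc_neg, cfc_mul (fun x => x) (fun x => x) a, cfc_id' ℝ a]
  have h2 : IsSelfAdjoint (-(a * a)) := by rw [← h1]; exact cfc_predicate _ _
  rw [expNegSq, ← CFC.real_exp_eq_normedSpace_exp h2, ← h1,
    ← cfc_comp' Real.exp (fun x : ℝ => -(x * x)) a]

theorem isSelfAdjoint_expNegSq {a : A} (ha : IsSelfAdjoint a) : IsSelfAdjoint (expNegSq a) := by
  rw [← cfc_gaussian_eq ha]
  exact cfc_predicate _ _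

theorem commute_expNegSq (a : A) : Commute a (expNegSq a) :=
  ((Commute.refl a).mul_right (Commute.refl a)).neg_right.exp_right

theorem norm_expNegSq_le {a : A} (ha : IsSelfAdjoint a) : ‖expNegSq a‖ ≤ 1 := by
  rw [← cfc_gaussian_eq ha]
  refine norm_cfc_le zero_le_one fun x _ => ?_
  rw [Real.norm_eq_abs, Real.abs_exp, Real.exp_le_one_iff]
  nlinarith [mul_self_nonneg x]

theorem norm_mul_expNegSq_le {a : A} (ha : IsSelfAdjoint a) : ‖a * expNegSq a‖ ≤ 1 := by
  have h : a * expNegSq a = cfc (fun x : ℝ => x * Real.exp (-(x * x))) a := by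
    rw [cfc_mul (fun x => x) _ a, cfc_id' ℝ a, cfc_gaussian_eq ha]
  rw [h]
  refine norm_cfc_le zero_le_one fun x _ => ?_
  rw [Real.norm_eq_abs, abs_mul, Real.abs_exp, Real.exp_neg, ← div_eq_mul_inv,
    div_le_one (Real.exp_pos _)]
  have h1 := Real.add_one_le_exp (x * x)
  have h2 := abs_mul_abs_self x
  nlinarith [sq_nonneg (|x| - 1), abs_nonneg x]

theorem expNegSq_smul (p : ℝ) (a : A) :
    expNegSq (p • a) = NormedSpace.exp ((-(p * p)) • (a * a)) := by
  rw [expNegSq, smul_mul_smul_comm, neg_smul]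

theorem hasDerivAt_expNegSq_smul {p : ℝ → ℝ} {p' s : ℝ} (hp : HasDerivAt p p' s) (a : A) :
    HasDerivAt (fun u => expNegSq (p u • a))
      ((-(2 * p s * p')) • (expNegSq (p s • a) * (a * a))) s := by
  simp only [expNegSq_smul]
  have h := (hasDerivAt_exp_smul_const (a * a) (-(p s * p s))).scomp s (hp.mul hp).neg
  have e : -(2 * p s * p') = -(p' * p s + p s * p') := by ring
  rw [e]
  exact h

/-- Mean value estimate along the quarter circle, using that its length is at most `2`. -/
theorem norm_sub_le_of_quarter_circle {F F' : ℝ → A} {K : ℝ} (hF : ∀ s, HasDerivAt F (F' s) s)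
    (hK : ∀ s, 0 ≤ Real.cos s → 0 ≤ Real.sin s → ‖F' s‖ ≤ K) :
    ‖F (Real.pi / 2) - F 0‖ ≤ 2 * K := by
  have hpi := Real.pi_pos
  have h := norm_image_sub_le_of_norm_deriv_le_segment' (f := F) (f' := F') (a := 0)
    (b := Real.pi / 2) (C := K) (fun s _ => (hF s).hasDerivWithinAt)
    (fun s hs => hK s (Real.cos_nonneg_of_neg_pi_div_two_le_of_le (by linarith [hs.1]) hs.2.le)
      (Real.sin_nonneg_of_nonneg_of_le_pi hs.1 (by linarith [hs.2])))
    (Real.pi / 2) ⟨by positivity, le_rfl⟩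
  have hK0 : 0 ≤ K := (norm_nonneg _).trans (hK 0 (by simp) (by simp))
  nlinarith [Real.pi_le_four]

/-- The path `e^{-cos²(s) a²} b e^{-sin²(s) a²}` carries the Gaussian from the left of `b` to its
right. Its derivative contains `a²b - ba² = aT - Ta`, with a single factor `a` next to a Gaussian.
The quarter circle produces the weight `2 sin s cos s`, which supplies the cosine or sine that this
Gaussian needs to absorb `a`. -/
theorem norm_expNegSq_commutator_le {a b : A} (ha : IsSelfAdjoint a) :
    ‖b * expNegSq a - expNegSq a * b‖ ≤ 8 * ‖a * b + b * a‖ := by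
  set T := a * b + b * a with hT
  let P := fun s : ℝ => expNegSq (Real.cos s • a)
  let Q := fun s : ℝ => expNegSq (Real.sin s • a)
  have hP (s : ℝ) : HasDerivAt P ((-(2 * Real.cos s * (-Real.sin s))) • (P s * (a * a))) s :=
    hasDerivAt_expNegSq_smul (Real.hasDerivAt_cos s) a
  have hQ (s : ℝ) : HasDerivAt Q ((-(2 * Real.sin s * Real.cos s)) • (Q s * (a * a))) s :=
    hasDerivAt_expNegSq_smul (Real.hasDerivAt_sin s) a
  have hcQ (s : ℝ) : a * Q s = Q s * a := by
    have h := ((Commute.refl a).smul_right (Real.sin s))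
    exact (h.mul_right h).neg_right.exp_right
  have hcP (s : ℝ) : a * P s = P s * a := by
    have h := ((Commute.refl a).smul_right (Real.cos s))
    exact (h.mul_right h).neg_right.exp_right
  have key := norm_sub_le_of_quarter_circle (F := fun s => P s * b * Q s)
    (K := 4 * ‖T‖) (fun s => ((hP s).mul_const b).mul (hQ s)) ?_
  · have h0 : expNegSq (0 : A) = 1 := by simp [expNegSq]
    simp only [P, Q, Real.cos_pi_div_two, Real.sin_pi_div_two, Real.cos_zero, Real.sin_zero,
      zero_smul, one_smul, h0, one_mul, mul_one] at key
    linarith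
  intro s hc hs
  have hsa : IsSelfAdjoint (Real.sin s • a) := (IsSelfAdjoint.all _).smul ha
  have hca : IsSelfAdjoint (Real.cos s • a) := (IsSelfAdjoint.all _).smul ha
  -- The cosine goes to the `a` beside `P s`, the sine to the `a` beside `Q s`.
  have e : ((-(2 * Real.cos s * (-Real.sin s))) • (P s * (a * a))) * b * Q s
        + P s * b * ((-(2 * Real.sin s * Real.cos s)) • (Q s * (a * a)))
      = (2 * Real.sin s) • ((Real.cos s • a) * P s * T * Q s)
        - (2 * Real.cos s) • (P s * T * ((Real.sin s • a) * Q s)) := by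
    have e1 : Q s * (a * a) = a * (a * Q s) := by rw [hcQ, ← mul_assoc, ← mul_assoc, hcQ]
    have e2 : P s * (a * a) = a * P s * a := by rw [hcP, mul_assoc]
    rw [e1, hT, e2]
    simp only [smul_mul_assoc, mul_smul_comm, smul_smul]
    have e3 : P s * b * (a * (a * Q s)) = P s * (b * a) * a * Q s := by noncomm_ring
    have e4 : P s * (a * b + b * a) * (a * Q s) = a * P s * b * a * Q s + P s * (b * a) * a * Q s := by
      rw [hcP]; noncomm_ring
    have e5 : a * P s * (a * b + b * a) * Q s = a * P s * a * b * Q s + a * P s * b * a * Q s := by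
      noncomm_ring
    rw [e3, e4, e5]
    module
  rw [e]
  have n1 : ‖(Real.cos s • a) * P s * T * Q s‖ ≤ ‖T‖ := by
    calc _ ≤ ‖(Real.cos s • a) * P s‖ * ‖T‖ * ‖Q s‖ :=
          (norm_mul_le _ _).trans (by gcongr; exact norm_mul_le _ _)
      _ ≤ 1 * ‖T‖ * 1 := by
          gcongr
          exacts [norm_mul_expNegSq_le hca, norm_expNegSq_le hsa]
      _ = ‖T‖ := by ring
  have n2 : ‖P s * T * ((Real.sin s • a) * Q s)‖ ≤ ‖T‖ := by
    calc _ ≤ ‖P s‖ * ‖T‖ * ‖(Real.sin s • a) * Q s‖ :=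
          (norm_mul_le _ _).trans (by gcongr; exact norm_mul_le _ _)
      _ ≤ 1 * ‖T‖ * 1 := by
          gcongr
          exacts [norm_expNegSq_le hca, norm_mul_expNegSq_le hsa]
      _ = ‖T‖ := by ring
  refine (norm_sub_le _ _).trans ?_
  rw [norm_smul, norm_smul, Real.norm_of_nonneg (by positivity), Real.norm_of_nonneg (by positivity)]
  nlinarith [Real.sin_le_one s, Real.cos_le_one s, norm_nonneg T,
    norm_nonneg ((Real.cos s • a) * P s * T * Q s), norm_nonneg (P s * T * ((Real.sin s • a) * Q s))]

/-- As `(a + b)² = a² + b² + T` with `a² ≥ 0`, one has `b² ≤ (a + b)² + ‖T‖`. Hence the Gaussian of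
the sum also absorbs the summand `b`, whatever the size of `a` and `b`. -/
theorem norm_smul_mul_expNegSq_add_le {a b : A} (ha : IsSelfAdjoint a) (hb : IsSelfAdjoint b)
    {p : ℝ} (hp : 0 ≤ p) (hp1 : p ≤ 1) :
    ‖(p • b) * expNegSq (p • (a + b))‖ ≤ 1 + ‖a * b + b * a‖ := by
  let _ := CStarAlgebra.spectralOrder A
  have _ := CStarAlgebra.spectralOrderedRing A
  set T := a * b + b * a with hT
  set c := a + b with hc
  set e := expNegSq (p • c)
  have hcs : IsSelfAdjoint (p • c) := (IsSelfAdjoint.all _).smul (ha.add hb)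
  have hcc : star c = c := (ha.add hb).star_eq
  have hes : star e = e := isSelfAdjoint_expNegSq hcs
  have hTs : IsSelfAdjoint T := by
    rw [isSelfAdjoint_iff, hT, star_add, star_mul, star_mul, ha.star_eq, hb.star_eq, add_comm]
  have h1 : b * b ≤ c * c + algebraMap ℝ A ‖T‖ := by
    have h2 : -T ≤ algebraMap ℝ A ‖-T‖ := hTs.neg.le_algebraMap_norm_self
    rw [norm_neg] at h2
    have e2 : c * c + algebraMap ℝ A ‖T‖ = b * b + (star a * a + (algebraMap ℝ A ‖T‖ - -T)) := by
      rw [hc, hT, ha.star_eq]; noncomm_ring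
    rw [e2]
    exact le_add_of_nonneg_right (add_nonneg (star_mul_self_nonneg a) (sub_nonneg.2 h2))
  have h3 := star_left_conjugate_le_conjugate h1 (p • e)
  have e3 : star (p • e) * (b * b) * (p • e) = star ((p • b) * e) * ((p • b) * e) := by
    simp only [star_mul, star_smul, hes, hb.star_eq, star_trivial, smul_mul_assoc, mul_smul_comm,
      mul_assoc]
  have e4 : star (p • e) * (c * c + algebraMap ℝ A ‖T‖) * (p • e)
      = star ((p • c) * e) * ((p • c) * e) + (p * p * ‖T‖) • (e * e) := by
    simp only [star_mul, star_smul, hes, hcc, star_trivial, smul_mul_assoc,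
      mul_smul_comm, mul_assoc, mul_add, add_mul, Algebra.algebraMap_eq_smul_one, smul_add,
      one_mul, smul_smul]
    module
  rw [e3, e4] at h3
  have h4 := CStarAlgebra.norm_le_norm_of_nonneg_of_le (star_mul_self_nonneg _) h3
  have h5 : ‖(p • c) * e‖ ≤ 1 := norm_mul_expNegSq_le hcs
  have h6 : ‖e * e‖ ≤ 1 := by
    have := norm_expNegSq_le hcs
    exact (norm_mul_le _ _).trans (mul_le_one₀ this (norm_nonneg _) this)
  have h7 : ‖(p * p * ‖T‖) • (e * e)‖ ≤ ‖T‖ := by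
    rw [norm_smul, Real.norm_of_nonneg (by positivity)]
    have : p * p ≤ 1 := mul_le_one₀ hp1 hp hp1
    calc _ ≤ 1 * ‖T‖ * 1 := by gcongr
      _ = ‖T‖ := by ring
  have h8 := h4.trans (norm_add_le _ _)
  rw [CStarRing.norm_star_mul_self, CStarRing.norm_star_mul_self] at h8
  -- The square of the norm is at most `1 + ‖T‖`, hence at most `(1 + ‖T‖)²`.
  nlinarith [norm_nonneg ((p • b) * e), norm_nonneg ((p • c) * e), norm_nonneg T]

/-- The path `e^{-cos²(s)(a+b)²} e^{-sin²(s)a²} e^{-sin²(s)b²}` joins the two terms. In its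
derivative `a²` cancels, leaving `T` and the commutator of `b²` with the middle Gaussian. The latter
is `bW + Wb`, where `W = O(‖T‖)` by `norm_expNegSq_commutator_le`, and the outer Gaussians absorb
`b`. -/
theorem norm_expNegSq_add_sub_le {a b : A} (ha : IsSelfAdjoint a) (hb : IsSelfAdjoint b)
    (hT1 : ‖a * b + b * a‖ ≤ 1) :
    ‖expNegSq (a + b) - expNegSq a * expNegSq b‖ ≤ 100 * ‖a * b + b * a‖ := by
  set T := a * b + b * a with hT
  let P := fun s : ℝ => expNegSq (Real.cos s • (a + b))
  let Q := fun s : ℝ => expNegSq (Real.sin s • a)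
  let R := fun s : ℝ => expNegSq (Real.sin s • b)
  have hP (s : ℝ) : HasDerivAt P
      ((-(2 * Real.cos s * (-Real.sin s))) • (P s * ((a + b) * (a + b)))) s :=
    hasDerivAt_expNegSq_smul (Real.hasDerivAt_cos s) (a + b)
  have hQ (s : ℝ) : HasDerivAt Q ((-(2 * Real.sin s * Real.cos s)) • (Q s * (a * a))) s :=
    hasDerivAt_expNegSq_smul (Real.hasDerivAt_sin s) a
  have hR (s : ℝ) : HasDerivAt R ((-(2 * Real.sin s * Real.cos s)) • (R s * (b * b))) s :=
    hasDerivAt_expNegSq_smul (Real.hasDerivAt_sin s) b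
  have hcQ (s : ℝ) : a * Q s = Q s * a := by
    have h := ((Commute.refl a).smul_right (Real.sin s))
    exact (h.mul_right h).neg_right.exp_right
  have hcR (s : ℝ) : b * R s = R s * b := by
    have h := ((Commute.refl b).smul_right (Real.sin s))
    exact (h.mul_right h).neg_right.exp_right
  have key := norm_sub_le_of_quarter_circle (F := fun s => P s * Q s * R s)
    (K := 50 * ‖T‖) (fun s => ((hP s).mul (hQ s)).mul (hR s)) ?_
  · have h0 : expNegSq (0 : A) = 1 := by simp [expNegSq]
    simp only [P, Q, R, Real.cos_pi_div_two, Real.sin_pi_div_two, Real.cos_zero, Real.sin_zero,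
      zero_smul, one_smul, h0, one_mul, mul_one] at key
    rw [norm_sub_rev]
    linarith
  intro s hc hs
  have hsa : IsSelfAdjoint (Real.sin s • a) := (IsSelfAdjoint.all _).smul ha
  have hsb : IsSelfAdjoint (Real.sin s • b) := (IsSelfAdjoint.all _).smul hb
  have hcs : IsSelfAdjoint (Real.cos s • (a + b)) := (IsSelfAdjoint.all _).smul (ha.add hb)
  set W := b * Q s - Q s * b with hW
  have nW : ‖W‖ ≤ 8 * ‖T‖ := by
    refine (norm_expNegSq_commutator_le hsa).trans ?_
    rw [smul_mul_assoc, mul_smul_comm, ← smul_add, norm_smul, Real.norm_of_nonneg hs]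
    nlinarith [Real.sin_le_one s, norm_nonneg T]
  have e : (((-(2 * Real.cos s * (-Real.sin s))) • (P s * ((a + b) * (a + b)))) * Q s
          + P s * ((-(2 * Real.sin s * Real.cos s)) • (Q s * (a * a)))) * R s
        + P s * Q s * ((-(2 * Real.sin s * Real.cos s)) • (R s * (b * b)))
      = (2 * Real.sin s * Real.cos s) • (P s * T * Q s * R s)
        + (2 * Real.sin s) • (P s * (Real.cos s • b) * W * R s)
        + (2 * Real.cos s) • (P s * W * ((Real.sin s • b) * R s)) := by
    have e1 : Q s * (a * a) = a * a * Q s := by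
      rw [← mul_assoc, ← hcQ, mul_assoc, ← hcQ, mul_assoc]
    have e2 : R s * (b * b) = b * b * R s := by
      rw [← mul_assoc, ← hcR, mul_assoc, ← hcR, mul_assoc]
    rw [e1, e2, hT, hW]
    simp only [smul_mul_assoc, mul_smul_comm, smul_smul, mul_add, add_mul, mul_sub, sub_mul,
      smul_add, smul_sub, mul_assoc]
    module
  simp only [Pi.mul_apply]
  rw [e]
  have nP := norm_expNegSq_le hcs
  have nQ := norm_expNegSq_le hsa
  have nR := norm_expNegSq_le hsb
  have nT := norm_nonneg T
  have n1 : ‖P s * T * Q s * R s‖ ≤ ‖T‖ := by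
    calc _ ≤ ‖P s‖ * ‖T‖ * ‖Q s‖ * ‖R s‖ := norm_mul₃_le.trans (by gcongr; exact norm_mul_le _ _)
      _ ≤ 1 * ‖T‖ * 1 * 1 := by gcongr
      _ = ‖T‖ := by ring
  -- The adjoint moves `b` to the other side of the self-adjoint Gaussian.
  have nPb : ‖P s * (Real.cos s • b)‖ ≤ 2 := by
    have h := norm_smul_mul_expNegSq_add_le ha hb hc (Real.cos_le_one s)
    rw [← norm_star, star_mul, (isSelfAdjoint_expNegSq hcs).star_eq,
      ((IsSelfAdjoint.all (Real.cos s)).smul hb).star_eq] at h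
    linarith
  have n2 : ‖P s * (Real.cos s • b) * W * R s‖ ≤ 16 * ‖T‖ := by
    calc _ ≤ ‖P s * (Real.cos s • b)‖ * ‖W‖ * ‖R s‖ := norm_mul₃_le
      _ ≤ 2 * (8 * ‖T‖) * 1 := by gcongr
      _ = 16 * ‖T‖ := by ring
  have n3 : ‖P s * W * ((Real.sin s • b) * R s)‖ ≤ 8 * ‖T‖ := by
    calc _ ≤ ‖P s‖ * ‖W‖ * ‖(Real.sin s • b) * R s‖ := norm_mul₃_le
      _ ≤ 1 * (8 * ‖T‖) * 1 := by
        gcongr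
        exact norm_mul_expNegSq_le hsb
      _ = 8 * ‖T‖ := by ring
  have hs1 := Real.sin_le_one s
  have hc1 := Real.cos_le_one s
  refine norm_add₃_le.trans ?_
  rw [norm_smul, norm_smul, norm_smul, Real.norm_of_nonneg (by positivity),
    Real.norm_of_nonneg (by positivity), Real.norm_of_nonneg (by positivity)]
  calc _ ≤ 2 * 1 * 1 * ‖T‖ + 2 * 1 * (16 * ‖T‖) + 2 * 1 * (8 * ‖T‖) := by gcongr
    _ = 50 * ‖T‖ := by ring

/-- The Gaussian is the square of the rescaled Gaussian. -/
theorem expNegSq_eq_mul_self (a : A) :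
    expNegSq a = expNegSq ((√2)⁻¹ • a) * expNegSq ((√2)⁻¹ • a) := by
  have h : (√2)⁻¹ * (√2)⁻¹ = (2 : ℝ)⁻¹ := by rw [← mul_inv, Real.mul_self_sqrt (by norm_num)]
  let _ := NormedAlgebra.restrictScalars ℚ ℝ A
  rw [expNegSq_smul, h, ← NormedSpace.exp_add_of_commute (Commute.refl _), ← add_smul, expNegSq]
  congr 1
  module

/-- Each Gaussian is split into two equal halves, the Gaussians of the elements scaled by `1/√2`.
One half absorbs the unbounded factor; the other remains available for `norm_expNegSq_add_sub_le`
and the commutator estimates. -/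
theorem norm_add_mul_expNegSq_sub_le {a b : A} (ha : IsSelfAdjoint a) (hb : IsSelfAdjoint b)
    (hT1 : ‖a * b + b * a‖ ≤ 1) :
    ‖(a + b) * expNegSq (a + b) - a * expNegSq a * expNegSq b
      - expNegSq a * (b * expNegSq b)‖ ≤ 1500 * ‖a * b + b * a‖ := by
  set ε := ‖a * b + b * a‖ with hε
  have hε0 : 0 ≤ ε := norm_nonneg _
  set r : ℝ := (√2)⁻¹ with hr
  have hr0 : 0 < r := by positivity
  have hrr : r * r = 2⁻¹ := by rw [← mul_inv, Real.mul_self_sqrt (by norm_num)]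
  have hr2 : r⁻¹ ≤ 2 := by
    rw [hr, inv_inv]
    nlinarith [Real.mul_self_sqrt (show (0 : ℝ) ≤ 2 by norm_num), Real.sqrt_nonneg 2]
  have hr1 : r ≤ 1 := by nlinarith
  have hra : IsSelfAdjoint (r • a) := (IsSelfAdjoint.all _).smul ha
  have hrb : IsSelfAdjoint (r • b) := (IsSelfAdjoint.all _).smul hb
  have hrab : IsSelfAdjoint (r • (a + b)) := (IsSelfAdjoint.all _).smul (ha.add hb)
  have hτ : ‖(r • a) * (r • b) + (r • b) * (r • a)‖ ≤ ε := by
    rw [smul_mul_smul_comm, smul_mul_smul_comm, ← smul_add, norm_smul, hrr]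
    norm_num
    linarith
  set g := expNegSq (r • a) with hg
  set k := expNegSq (r • b) with hk
  set m := expNegSq (r • (a + b)) with hm
  -- Undoing the scaling costs a factor `√2`, rounded up to `2`.
  have unscale {x y : A} {K : ℝ} (h : ‖(r • x) * y‖ ≤ K) : ‖x * y‖ ≤ 2 * K := by
    have h1 : x * y = r⁻¹ • ((r • x) * y) := by
      rw [smul_mul_assoc, smul_smul, inv_mul_cancel₀ hr0.ne', one_smul]
    rw [h1, norm_smul, Real.norm_of_nonneg (by positivity)]
    gcongr
  have ng : ‖g‖ ≤ 1 := norm_expNegSq_le hra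
  have nk : ‖k‖ ≤ 1 := norm_expNegSq_le hrb
  have nm : ‖m‖ ≤ 1 := norm_expNegSq_le hrab
  have nag : ‖a * g‖ ≤ 2 := by simpa only [mul_one] using unscale (norm_mul_expNegSq_le hra)
  have nbk : ‖b * k‖ ≤ 2 := by simpa only [mul_one] using unscale (norm_mul_expNegSq_le hrb)
  have nxm : ‖(a + b) * m‖ ≤ 2 := by simpa only [mul_one] using unscale (norm_mul_expNegSq_le hrab)
  have cancel {x y : A} (h : (r • x) * y = y * (r • x)) : x * y = y * x := by
    rw [smul_mul_assoc, mul_smul_comm] at h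
    exact smul_right_injective _ hr0.ne' h
  have cag : a * g = g * a := cancel (commute_expNegSq (r • a))
  have cbk : b * k = k * b := cancel (commute_expNegSq (r • b))
  have cxm : (a + b) * m = m * (a + b) := cancel (commute_expNegSq (r • (a + b)))
  have nd : ‖m - g * k‖ ≤ 100 * ε := by
    have h := norm_expNegSq_add_sub_le hra hrb (hτ.trans hT1)
    rw [← smul_add] at h
    linarith
  have nd' : ‖m - k * g‖ ≤ 100 * ε := by
    rw [← norm_star, star_sub, star_mul, (isSelfAdjoint_expNegSq hra).star_eq,
      (isSelfAdjoint_expNegSq hrb).star_eq, (isSelfAdjoint_expNegSq hrab).star_eq]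
    exact nd
  -- Both products are close to the self-adjoint `m`, so they are close to each other.
  have nkg : ‖k * g - g * k‖ ≤ 200 * ε := by
    have h : k * g - g * k = (m - g * k) - (m - k * g) := by abel
    rw [h]
    linarith [norm_sub_le (m - g * k) (m - k * g)]
  have scale {x y : A} {K : ℝ} (h : ‖(r • x) * y - y * (r • x)‖ ≤ K) : ‖x * y - y * x‖ ≤ 2 * K := by
    have h1 : x * y - y * x = r⁻¹ • ((r • x) * y - y * (r • x)) := by
      rw [smul_mul_assoc, mul_smul_comm, ← smul_sub, smul_smul, inv_mul_cancel₀ hr0.ne', one_smul]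
    rw [h1, norm_smul, Real.norm_of_nonneg (by positivity)]
    gcongr
  have nbg : ‖b * g - g * b‖ ≤ 16 * ε := by
    have h := scale ((norm_expNegSq_commutator_le (b := r • b) hra).trans
      (mul_le_mul_of_nonneg_left hτ (by norm_num)))
    linarith
  have nak : ‖k * a - a * k‖ ≤ 16 * ε := by
    rw [norm_sub_rev]
    rw [add_comm] at hτ
    have h := scale ((norm_expNegSq_commutator_le (b := r • a) hrb).trans
      (mul_le_mul_of_nonneg_left hτ (by norm_num)))
    linarith
  rw [expNegSq_eq_mul_self (a + b), expNegSq_eq_mul_self a, expNegSq_eq_mul_self b]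
  have h1 : (a + b) * m * (g * k) = m * (a + b) * (g * k) := by rw [cxm]
  have h2 : a * g * g * k * k = g * a * g * k * k := by rw [cag]
  have h3 : g * g * (b * k) * k = g * g * (k * b) * k := by rw [cbk]
  -- Telescoping: one `m` becomes `g * k`, `a + b` moves across the other `m`, then `b` moves across
  -- `g` and `a` across `k`. Every summand has one small factor, and `a`, `b` or `a + b` occurs only
  -- inside a commutator or beside its own Gaussian. The seven bounds add up to `1432 * ε`.
  have key : (a + b) * (m * m) - a * (g * g) * (k * k) - g * g * (b * (k * k))
      = ((a + b) * m) * (m - g * k) + m * (b * g - g * b) * k + (m - g * k) * (a * g) * k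
        + (m - g * k) * g * (b * k) + g * (k * a - a * k) * (g * k)
        + (a * g) * (k * g - g * k) * k + g * (k * g - g * k) * (b * k) := by
    have h4 : (a * g) * (k * g - g * k) * k = g * a * (k * g - g * k) * k := by rw [cag]
    rw [h4]
    linear_combination (norm := noncomm_ring) h1 - h2 - h3
  rw [key]
  have b3 {x y z : A} {X Y Z : ℝ} (hx : ‖x‖ ≤ X) (hy : ‖y‖ ≤ Y) (hz : ‖z‖ ≤ Z) :
      ‖x * y * z‖ ≤ X * Y * Z := by
    have hX := (norm_nonneg _).trans hx
    have hY := (norm_nonneg _).trans hy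
    refine norm_mul₃_le.trans ?_
    gcongr
  have t1 : ‖((a + b) * m) * (m - g * k)‖ ≤ 2 * (100 * ε) := (norm_mul_le _ _).trans (by gcongr)
  have t2 := b3 nm nbg nk
  have t3 := b3 nd nag nk
  have t4 := b3 nd ng nbk
  have ngk : ‖g * k‖ ≤ 1 := (norm_mul_le _ _).trans (mul_le_one₀ ng (norm_nonneg _) nk)
  have t5 := b3 ng nak ngk
  have t6 := b3 nag nkg nk
  have t7 := b3 ng nkg nbk
  refine (norm_add_le_of_le (norm_add_le_of_le (norm_add_le_of_le (norm_add_le_of_le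
    (norm_add_le_of_le (norm_add_le_of_le t1 t2) t3) t4) t5) t6) t7).trans ?_
  linarith

end Bounded

variable {C : Type*} [NonUnitalCStarAlgebra C]

/-! ### Strong convergence of multipliers and of their functional calculus. -/

section StrongConvergence

theorem norm_fst_apply_le (a : 𝓜(ℂ, C)) (x : C) : ‖a.fst x‖ ≤ ‖a‖ * ‖x‖ := by
  rw [← DoubleCentralizer.norm_fst]
  exact a.fst.le_opNorm x

theorem norm_le_of_fst_apply_le {a : 𝓜(ℂ, C)} {K : ℝ} (hK : 0 ≤ K)
    (h : ∀ x, ‖a.fst x‖ ≤ K * ‖x‖) : ‖a‖ ≤ K := by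
  rw [← DoubleCentralizer.norm_fst]
  exact a.fst.opNorm_le_bound hK h

/-- Multiplication is jointly continuous for strong convergence on norm-bounded sets; this lets
products of functional calculi pass to the limit. -/
theorem tendsto_fst_apply {a : ℕ → 𝓜(ℂ, C)} {b : 𝓜(ℂ, C)} {K : ℝ} (ha : ∀ n, ‖a n‖ ≤ K)
    (h : ∀ x, Tendsto (fun n => (a n).fst x) atTop (𝓝 (b.fst x))) {y : ℕ → C} {z : C}
    (hy : Tendsto y atTop (𝓝 z)) : Tendsto (fun n => (a n).fst (y n)) atTop (𝓝 (b.fst z)) := by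
  have h1 : Tendsto (fun n => (a n).fst (y n - z)) atTop (𝓝 0) := by
    have h2 : Tendsto (fun n => K * ‖y n - z‖) atTop (𝓝 0) := by
      simpa using (tendsto_iff_norm_sub_tendsto_zero.1 hy).const_mul K
    refine squeeze_zero_norm (fun n => (norm_fst_apply_le _ _).trans ?_) h2
    gcongr
    exact ha n
  have h3 := h1.add (h z)
  simpa using h3

theorem tendsto_fst_of_dense {a : ℕ → 𝓜(ℂ, C)} {b : 𝓜(ℂ, C)} {K : ℝ} (ha : ∀ n, ‖a n‖ ≤ K)
    {S : Set C} (hS : Dense S) (h : ∀ x ∈ S, Tendsto (fun n => (a n).fst x) atTop (𝓝 (b.fst x)))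
    (x : C) : Tendsto (fun n => (a n).fst x) atTop (𝓝 (b.fst x)) := by
  have hK : 0 ≤ K := (norm_nonneg _).trans (ha 0)
  rw [Metric.tendsto_atTop]
  intro ε hε
  obtain ⟨y, hyS, hy⟩ := hS.exists_dist_lt x (show 0 < ε / (3 * (K + ‖b‖ + 1)) by positivity)
  obtain ⟨n₀, hn₀⟩ := Metric.tendsto_atTop.1 (h y hyS) (ε / 3) (by positivity)
  refine ⟨n₀, fun n hn => ?_⟩
  rw [dist_eq_norm, lt_div_iff₀ (by positivity)] at hy
  have h1 := hn₀ n hn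
  rw [dist_eq_norm] at h1 ⊢
  have h2 : (a n).fst x - b.fst x
      = (a n).fst (x - y) + ((a n).fst y - b.fst y) - b.fst (x - y) := by
    simp only [map_sub]; abel
  have h3 := norm_fst_apply_le (a n) (x - y)
  have h4 := norm_fst_apply_le b (x - y)
  have h5 : ‖a n‖ * ‖x - y‖ ≤ K * ‖x - y‖ := by gcongr; exact ha n
  rw [h2]
  refine (norm_sub_le _ _).trans_lt ?_
  have h6 := norm_add_le ((a n).fst (x - y)) ((a n).fst y - b.fst y)
  nlinarith [norm_nonneg (x - y), norm_nonneg b]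

open Classical in
/-- Extension by zero of a function on `K ⊆ ℂ`. -/
noncomputable def extendZero {K : Set ℂ} (f : K → ℂ) (w : ℂ) : ℂ :=
  if h : w ∈ K then f ⟨w, h⟩ else 0

theorem extendZero_apply {K : Set ℂ} (f : K → ℂ) {w : ℂ} (h : w ∈ K) :
    extendZero f w = f ⟨w, h⟩ := dif_pos h

theorem continuousOn_extendZero {K : Set ℂ} (f : C(K, ℂ)) : ContinuousOn (extendZero f) K := by
  rw [continuousOn_iff_continuous_domRestrict]
  convert f.continuous using 1
  ext w
  simp [extendZero_apply f w.2]

/-- The continuous functional calculus of normal elements whose spectra lie in a fixed compact set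
is continuous for the strong-* topology. -/
theorem tendsto_cfc_fst {K : Set ℂ} (hK : IsCompact K) {r : ℕ → 𝓜(ℂ, C)} {s : 𝓜(ℂ, C)}
    (hr : ∀ n, IsStarNormal (r n)) (hs : IsStarNormal s) (hrK : ∀ n, spectrum ℂ (r n) ⊆ K)
    (hsK : spectrum ℂ s ⊆ K)
    (h : ∀ x, Tendsto (fun n => (r n).fst x) atTop (𝓝 (s.fst x)))
    (h' : ∀ x, Tendsto (fun n => (star (r n)).fst x) atTop (𝓝 ((star s).fst x)))
    {F : ℂ → ℂ} (hF : ContinuousOn F K) (x : C) :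
    Tendsto (fun n => (cfc F (r n)).fst x) atTop (𝓝 ((cfc F s).fst x)) := by
  have _ : CompactSpace K := isCompact_iff_compactSpace.1 hK
  suffices H : ∀ f : C(K, ℂ), ∀ x, Tendsto (fun n => (cfc (extendZero f) (r n)).fst x) atTop
      (𝓝 ((cfc (extendZero f) s).fst x)) by
    have e : ∀ a : 𝓜(ℂ, C), spectrum ℂ a ⊆ K →
        cfc F a = cfc (extendZero (⟨K.domRestrict F, hF.domRestrict⟩ : C(K, ℂ))) a := fun a ha =>
      cfc_congr fun w hw => by rw [extendZero_apply _ (ha hw)]; rfl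
    rw [e s hsK]
    simp only [fun n => e (r n) (hrK n)]
    exact H _ x
  clear hF F x
  have hc : ∀ (f : C(K, ℂ)) (a : 𝓜(ℂ, C)), spectrum ℂ a ⊆ K →
      ContinuousOn (extendZero f) (spectrum ℂ a) := fun f a ha => (continuousOn_extendZero f).mono ha
  have hn : ∀ (f : C(K, ℂ)) (a : 𝓜(ℂ, C)), spectrum ℂ a ⊆ K → ‖cfc (extendZero f) a‖ ≤ ‖f‖ :=
    fun f a ha => norm_cfc_le (norm_nonneg _) fun w hw => by
      rw [extendZero_apply _ (ha hw)]; exact f.norm_coe_le_norm _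
  intro f
  -- Stone–Weierstrass: the functions for which the claim holds contain the constants, `z` and `z̄`,
  -- and are closed under sums, products and uniform limits. Convergence of the adjoints is needed
  -- for `z̄`.
  induction f using ContinuousMap.induction_on_of_compact with
  | const c =>
    intro x
    have e : ∀ a : 𝓜(ℂ, C), IsStarNormal a → spectrum ℂ a ⊆ K →
        cfc (extendZero (ContinuousMap.const K c)) a = algebraMap ℂ _ c := fun a ha haK => by
      rw [← cfc_const c a]
      exact cfc_congr fun w hw => by rw [extendZero_apply _ (haK hw)]; rfl
    simp only [e s hs hsK, fun n => e (r n) (hr n) (hrK n)]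
    exact tendsto_const_nhds
  | id =>
    intro x
    have e : ∀ a : 𝓜(ℂ, C), IsStarNormal a → spectrum ℂ a ⊆ K →
        cfc (extendZero (ContinuousMap.restrict K (ContinuousMap.id ℂ))) a = a :=
      fun a ha haK => by
        conv_rhs => rw [← cfc_id' ℂ a]
        exact cfc_congr fun w hw => by rw [extendZero_apply _ (haK hw)]; rfl
    simp only [e s hs hsK, fun n => e (r n) (hr n) (hrK n)]
    exact h x
  | star_id =>
    intro x
    have e : ∀ a : 𝓜(ℂ, C), IsStarNormal a → spectrum ℂ a ⊆ K →
        cfc (extendZero (star (ContinuousMap.restrict K (ContinuousMap.id ℂ)) : C(K, ℂ))) a = star a :=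
      fun a ha haK => by
        conv_rhs => rw [← cfc_id' ℂ a, ← cfc_star]
        exact cfc_congr fun w hw => by rw [extendZero_apply _ (haK hw)]; rfl
    simp only [e s hs hsK, fun n => e (r n) (hr n) (hrK n)]
    exact h' x
  | add f g hf hg =>
    intro x
    have e : ∀ a : 𝓜(ℂ, C), spectrum ℂ a ⊆ K →
        cfc (extendZero (f + g)) a = cfc (extendZero f) a + cfc (extendZero g) a := fun a haK => by
      rw [← cfc_add a (extendZero f) (extendZero g) (hc f a haK) (hc g a haK)]
      exact cfc_congr fun w hw => by simp only [extendZero_apply _ (haK hw)]; rfl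
    simp only [e s hsK, fun n => e (r n) (hrK n)]
    exact (hf x).add (hg x)
  | mul f g hf hg =>
    intro x
    have e : ∀ a : 𝓜(ℂ, C), spectrum ℂ a ⊆ K →
        cfc (extendZero (f * g)) a = cfc (extendZero f) a * cfc (extendZero g) a := fun a haK => by
      rw [← cfc_mul (extendZero f) (extendZero g) a (hc f a haK) (hc g a haK)]
      exact cfc_congr fun w hw => by simp only [extendZero_apply _ (haK hw)]; rfl
    simp only [e s hsK, fun n => e (r n) (hrK n)]
    exact tendsto_fst_apply (fun n => hn f _ (hrK n)) hf (hg x)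
  | frequently f hf =>
    intro x
    rw [Metric.tendsto_atTop]
    intro ε hε
    obtain ⟨g, hg, hgf⟩ := (hf.and_eventually
      (Metric.ball_mem_nhds f (show 0 < ε / (3 * (‖x‖ + 1)) by positivity))).exists
    obtain ⟨n₀, hn₀⟩ := Metric.tendsto_atTop.1 (hg x) (ε / 3) (by positivity)
    refine ⟨n₀, fun n hn' => ?_⟩
    rw [dist_comm, dist_eq_norm, lt_div_iff₀ (by positivity)] at hgf
    have e : ∀ a : 𝓜(ℂ, C), spectrum ℂ a ⊆ K →
        ‖(cfc (extendZero f) a).fst x - (cfc (extendZero g) a).fst x‖ ≤ ‖f - g‖ * ‖x‖ :=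
      fun a haK => by
        have e1 : cfc (extendZero (f - g)) a = cfc (extendZero f) a - cfc (extendZero g) a := by
          rw [← cfc_sub (extendZero f) (extendZero g) a (hc f a haK) (hc g a haK)]
          exact cfc_congr fun w hw => by simp only [extendZero_apply _ (haK hw)]; rfl
        have e2 := norm_fst_apply_le (cfc (extendZero (f - g)) a) x
        rw [e1] at e2
        refine e2.trans ?_
        rw [← e1]
        gcongr
        exact hn _ a haK
    have h1 := hn₀ n hn'
    have h2 := e _ (hrK n)
    have h3 := e s hsK
    rw [← dist_eq_norm] at h2 h3
    rw [dist_comm] at h3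
    have h4 := dist_triangle4 ((cfc (extendZero f) (r n)).fst x) ((cfc (extendZero g) (r n)).fst x)
      ((cfc (extendZero g) s).fst x) ((cfc (extendZero f) s).fst x)
    nlinarith [norm_nonneg (f - g), norm_nonneg x]

end StrongConvergence

/-! ### The image of the real line under `x ↦ (x + i)⁻¹`. -/

section Circle

/-- The circle that contains the spectra of all resolvents `(D + i)⁻¹`. -/
def resolventCircle : Set ℂ := {w | Complex.normSq w + w.im = 0}

theorem norm_le_one_of_mem_resolventCircle {w : ℂ} (hw : w ∈ resolventCircle) : ‖w‖ ≤ 1 := by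
  have h : Complex.normSq w + w.im = 0 := hw
  rw [Complex.normSq_eq_norm_sq] at h
  have h1 := (abs_le.1 (Complex.abs_im_le_norm w)).1
  nlinarith [norm_nonneg w]

theorem isCompact_resolventCircle : IsCompact resolventCircle := by
  refine Metric.isCompact_of_isClosed_isBounded ?_ ?_
  · exact isClosed_eq (by fun_prop) continuous_const
  · refine (Metric.isBounded_closedBall (x := (0 : ℂ)) (r := 1)).subset fun w hw => ?_
    simpa using norm_le_one_of_mem_resolventCircle hw

theorem im_inv_of_mem_resolventCircle {w : ℂ} (hw : w ∈ resolventCircle) (hw0 : w ≠ 0) :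
    (w⁻¹).im = 1 := by
  have h : Complex.normSq w + w.im = 0 := hw
  rw [Complex.inv_im, div_eq_one_iff_eq (by simpa using hw0)]
  linarith

theorem mem_resolventCircle_of_im_inv {w : ℂ} (hw : (w⁻¹).im = 1) : w ∈ resolventCircle := by
  have hw0 : w ≠ 0 := by rintro rfl; simp at hw
  rw [Complex.inv_im, div_eq_one_iff_eq (by simpa using hw0)] at hw
  change Complex.normSq w + w.im = 0
  linarith

theorem spectrum_resolvent_subset {D : C →ₗ.[ℂ] C} (hD : IsSelfAdjointMultiplier D) :
    spectrum ℂ (resolvent D Complex.I) ⊆ resolventCircle := fun w hw => by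
  by_cases hw0 : w = 0
  · simp [hw0, resolventCircle]
  · exact mem_resolventCircle_of_im_inv (im_inv_of_mem_spectrum hD hw hw0)

/-- The function on `ℂ` that corresponds to `f` under `w = (x + i)⁻¹`. -/
noncomputable def circleFun (f : ℝ → ℂ) (w : ℂ) : ℂ := if w = 0 then 0 else f (w⁻¹).re

/-- Only `w = 0` is critical. Off `0` the circle satisfies `Im w⁻¹ = 1`, so `w → 0` forces `|Re w⁻¹|
→ ∞`, where `f` vanishes. Working on the whole circle gives one compact set valid for all operators
at once. -/
theorem continuousOn_circleFun (f : C₀(ℝ, ℂ)) : ContinuousOn (circleFun f) resolventCircle := by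
  intro w hw
  by_cases hw0 : w = 0
  · subst hw0
    rw [Metric.continuousWithinAt_iff]
    intro ε hε
    have h := (zero_at_infty f).eventually (Metric.ball_mem_nhds 0 hε)
    obtain ⟨M, hM⟩ := Metric.closedBall_compl_subset_of_mem_cocompact h (0 : ℝ)
    -- From `‖v⁻¹‖ ≤ |Re v⁻¹| + 1` one gets `|Re v⁻¹| > |M| + 1`.
    refine ⟨(|M| + 2)⁻¹, by positivity, ?_⟩
    intro v hv hvd
    by_cases hv0 : v = 0
    · simpa [hv0, circleFun] using hε
    rw [dist_zero_right] at hvd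
    have h1 : |M| + 2 < ‖v⁻¹‖ := by
      rw [norm_inv]
      exact (lt_inv_comm₀ (norm_pos_iff.2 hv0) (by positivity)).1 hvd
    have h2 := Complex.norm_le_abs_re_add_abs_im v⁻¹
    rw [im_inv_of_mem_resolventCircle hv hv0, abs_one] at h2
    have h3 : (v⁻¹).re ∈ (Metric.closedBall (0 : ℝ) M)ᶜ := by
      simp only [Set.mem_compl_iff, Metric.mem_closedBall, dist_zero_right, Real.norm_eq_abs,
        not_le]
      linarith [le_abs_self M]
    have h4 := hM h3
    simpa [hv0, circleFun] using h4
  · refine ContinuousAt.continuousWithinAt ?_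
    have h : ContinuousAt (fun w : ℂ => f (w⁻¹).re) w :=
      (f.continuous.comp Complex.continuous_re).continuousAt.comp (continuousAt_inv₀ hw0)
    refine h.congr ?_
    filter_upwards [isOpen_ne.mem_nhds hw0] with v hv
    rw [circleFun, if_neg hv]

theorem continuousOn_circleFun_gaussian {t : ℝ} (ht : 0 < t) :
    ContinuousOn (circleFun (gaussian t)) resolventCircle := by
  refine continuousOn_circleFun ⟨⟨gaussian t, by unfold gaussian; fun_prop⟩, ?_⟩
  have h := tendsto_rpow_abs_mul_exp_neg_mul_sq_cocompact (show 0 < t⁻¹ ^ 2 by positivity) 0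
  rw [tendsto_zero_iff_norm_tendsto_zero] at h ⊢
  refine h.congr fun x => ?_
  change _ = ‖((Real.exp (-(t⁻¹ ^ 2 * x ^ 2)) : ℝ) : ℂ)‖
  rw [Complex.norm_real, Real.rpow_zero, one_mul, neg_mul]

theorem continuousOn_circleFun_xGaussian {t : ℝ} (ht : 0 < t) :
    ContinuousOn (circleFun (xGaussian t)) resolventCircle := by
  refine continuousOn_circleFun ⟨⟨xGaussian t, by unfold xGaussian; fun_prop⟩, ?_⟩
  have h := (tendsto_rpow_abs_mul_exp_neg_mul_sq_cocompact (show 0 < t⁻¹ ^ 2 by positivity)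
    1).const_mul (t⁻¹)
  rw [mul_zero, tendsto_zero_iff_norm_tendsto_zero] at h
  rw [tendsto_zero_iff_norm_tendsto_zero]
  refine h.congr fun x => ?_
  change _ = ‖((t⁻¹ * x * Real.exp (-(t⁻¹ ^ 2 * x ^ 2)) : ℝ) : ℂ)‖
  rw [Complex.norm_real, Real.rpow_one, neg_mul, ← mul_assoc]
  simp only [norm_mul, norm_abs_eq_norm, Real.norm_eq_abs]

end Circle

/-! ### Resolvents of bounded self-adjoint elements. -/

section BoundedResolvent

variable {A : Type*} [CStarAlgebra A]

/-- The resolvent `(a + i)⁻¹` of a bounded self-adjoint element. -/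
noncomputable def boundedResolvent (a : A) : A := cfc (fun z : ℂ => (z + Complex.I)⁻¹) a

theorem add_I_ne_zero {z : ℂ} (hz : z.im = 0) : z + Complex.I ≠ 0 := by
  intro h
  have := congrArg Complex.im h
  simp [hz] at this

theorem sub_I_ne_zero {z : ℂ} (hz : z.im = 0) : z - Complex.I ≠ 0 := by
  intro h
  have := congrArg Complex.im h
  simp [hz] at this

theorem continuousOn_inv_add_I {a : A} (ha : IsSelfAdjoint a) :
    ContinuousOn (fun z : ℂ => (z + Complex.I)⁻¹) (spectrum ℂ a) :=
  ContinuousOn.inv₀ (by fun_prop) fun _ hz => add_I_ne_zero (ha.im_eq_zero_of_mem_spectrum hz)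

theorem inv_add_I_mem_resolventCircle {z : ℂ} (hz : z.im = 0) :
    (z + Complex.I)⁻¹ ∈ resolventCircle :=
  mem_resolventCircle_of_im_inv (by simp [hz])

theorem spectrum_boundedResolvent_subset {a : A} (ha : IsSelfAdjoint a) :
    spectrum ℂ (boundedResolvent a) ⊆ resolventCircle := by
  have hn := ha.isStarNormal
  rw [boundedResolvent, cfc_map_spectrum _ a hn (continuousOn_inv_add_I ha)]
  rintro _ ⟨z, hz, rfl⟩
  exact inv_add_I_mem_resolventCircle (ha.im_eq_zero_of_mem_spectrum hz)

theorem norm_boundedResolvent_le {a : A} (ha : IsSelfAdjoint a) : ‖boundedResolvent a‖ ≤ 1 :=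
  norm_cfc_le zero_le_one fun _ hz => norm_le_one_of_mem_resolventCircle
    (inv_add_I_mem_resolventCircle (ha.im_eq_zero_of_mem_spectrum hz))

theorem boundedResolvent_mul {a : A} (ha : IsSelfAdjoint a) :
    boundedResolvent a * (a + Complex.I • 1) = 1 := by
  have hn := ha.isStarNormal
  have h1 : a + Complex.I • 1 = cfc (fun z : ℂ => z + Complex.I) a := by
    rw [cfc_add_const Complex.I (fun z => z) a, cfc_id' ℂ a, Algebra.algebraMap_eq_smul_one]
  rw [h1, boundedResolvent, ← cfc_mul _ _ a (continuousOn_inv_add_I ha) (by fun_prop),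
    ← cfc_const_one ℂ a]
  exact cfc_congr fun z hz => inv_mul_cancel₀ (add_I_ne_zero (ha.im_eq_zero_of_mem_spectrum hz))

theorem star_boundedResolvent_mul {a : A} (ha : IsSelfAdjoint a) :
    star (boundedResolvent a) * (a + (-Complex.I) • 1) = 1 := by
  have hn := ha.isStarNormal
  have hc := continuousOn_inv_add_I ha
  have h1 : a + (-Complex.I) • 1 = cfc (fun z : ℂ => z + (-Complex.I)) a := by
    rw [cfc_add_const (-Complex.I) (fun z => z) a, cfc_id' ℂ a, Algebra.algebraMap_eq_smul_one]
  rw [h1, boundedResolvent, ← cfc_star, ← cfc_mul _ _ a hc.star (by fun_prop),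
    ← cfc_const_one ℂ a]
  refine cfc_congr fun z hz => ?_
  have him := ha.im_eq_zero_of_mem_spectrum hz
  have h2 : star ((z + Complex.I)⁻¹) = (z - Complex.I)⁻¹ := by
    rw [star_inv₀]
    congr 1
    apply Complex.ext <;> simp [him]
  rw [h2, ← sub_eq_add_neg]
  exact inv_mul_cancel₀ (sub_I_ne_zero him)

/-- For a bounded element, the calculus through the resolvent, as used for unbounded operators,
agrees with the ordinary one. This connects the bounded estimates with `funcCalc`. -/
theorem cfc_boundedResolvent {a : A} (ha : IsSelfAdjoint a) {f : ℝ → ℂ}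
    (hf : ContinuousOn (circleFun f) resolventCircle) :
    cfc (circleFun f) (boundedResolvent a) = cfc (fun z : ℂ => f z.re) a := by
  have hn := ha.isStarNormal
  have hsub : (fun z : ℂ => (z + Complex.I)⁻¹) '' spectrum ℂ a ⊆ resolventCircle := by
    rintro _ ⟨z, hz, rfl⟩
    exact inv_add_I_mem_resolventCircle (ha.im_eq_zero_of_mem_spectrum hz)
  rw [boundedResolvent, ← cfc_comp' (circleFun f) _ a (hf.mono hsub) (continuousOn_inv_add_I ha)]
  refine cfc_congr fun z hz => ?_
  have h := add_I_ne_zero (ha.im_eq_zero_of_mem_spectrum hz)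
  simp [circleFun, h]

theorem cfc_gaussian_re {a : A} (ha : IsSelfAdjoint a) (t : ℝ) :
    cfc (fun z : ℂ => gaussian t z.re) a = expNegSq (t⁻¹ • a) := by
  have h : IsSelfAdjoint (t⁻¹ • a) := (IsSelfAdjoint.all _).smul ha
  rw [← cfc_gaussian_eq h, ← cfc_comp_smul t⁻¹ (fun x : ℝ => Real.exp (-(x * x))) a,
    cfc_real_eq_complex]
  refine cfc_congr fun z _ => ?_
  simp only [gaussian, smul_eq_mul]
  congr 3
  ring

theorem cfc_xGaussian_re {a : A} (ha : IsSelfAdjoint a) (t : ℝ) :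
    cfc (fun z : ℂ => xGaussian t z.re) a = (t⁻¹ • a) * expNegSq (t⁻¹ • a) := by
  have h : IsSelfAdjoint (t⁻¹ • a) := (IsSelfAdjoint.all _).smul ha
  have h1 : (t⁻¹ • a) * expNegSq (t⁻¹ • a)
      = cfc (fun x : ℝ => x * Real.exp (-(x * x))) (t⁻¹ • a) := by
    rw [cfc_mul (fun x => x) _ (t⁻¹ • a), cfc_id' ℝ (t⁻¹ • a), cfc_gaussian_eq h]
  rw [h1, ← cfc_comp_smul t⁻¹ (fun x : ℝ => x * Real.exp (-(x * x))) a,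
    cfc_real_eq_complex]
  refine cfc_congr fun z _ => ?_
  simp only [xGaussian, smul_eq_mul]
  congr 4
  ring

end BoundedResolvent

/-! ### Strong resolvent convergence from convergence on a core. -/

section Core

/-- `E + z` is onto, and its value depends continuously on the point of the graph of `E`, in which
the graph over the core is dense. -/
theorem IsCore.dense_range_add_smul {E : C →ₗ.[ℂ] C} {𝒞 : Submodule ℂ C}
    (hE : IsSelfAdjointMultiplier E) (h𝒞 : IsCore E 𝒞) {z : ℂ}
    (hz : z = Complex.I ∨ z = -Complex.I) :
    Dense {c : C | ∃ x : E.domain, (x : C) ∈ 𝒞 ∧ E x + z • (x : C) = c} := by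
  intro c
  obtain ⟨x, rfl⟩ := exists_add_smul_eq hE hz c
  have hcl : (E.domRestrict 𝒞).IsClosable :=
    hE.closed.isClosable.leIsClosable LinearPMap.domRestrict_le
  have hx : ((x : C), E x) ∈ closure ((E.domRestrict 𝒞).graph : Set (C × C)) := by
    have h := E.mem_graph x
    have e : E.graph = (E.domRestrict 𝒞).graph.topologicalClosure := by
      rw [hcl.graph_closure_eq_closure_graph, h𝒞.hasCore.closure_eq]
    rw [e] at h
    exact h
  have hcont : Continuous fun p : C × C => p.2 + z • p.1 := by fun_prop
  refine map_mem_closure (f := fun p : C × C => p.2 + z • p.1) hcont hx ?_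
  intro p hp
  obtain ⟨y, hy1, hy2⟩ := (LinearPMap.mem_graph_iff _).1 hp
  refine ⟨⟨y, y.2.2⟩, y.2.1, ?_⟩
  change _ = p.2 + z • p.1
  rw [← hy1, ← hy2]
  rfl

/-- Bounded self-adjoint multipliers that converge to `E` on a core of `E` converge to `E` in the
strong resolvent sense. -/
theorem tendsto_funcCalc {E : C →ₗ.[ℂ] C} {𝒞 : Submodule ℂ C}
    (hE : IsSelfAdjointMultiplier E) (h𝒞 : IsCore E 𝒞) {a : ℕ → 𝓜(ℂ, C)}
    (ha : ∀ n, IsSelfAdjoint (a n))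
    (h : ∀ x : E.domain, (x : C) ∈ 𝒞 → Tendsto (fun n => (a n).fst x) atTop (𝓝 (E x)))
    {f : ℝ → ℂ} (hf : ContinuousOn (circleFun f) resolventCircle) (x : C) :
    Tendsto (fun n => (cfc (fun z : ℂ => f z.re) (a n)).fst x) atTop
      (𝓝 ((funcCalc E f).fst x)) := by
  have main : ∀ z : ℂ, z = Complex.I ∨ z = -Complex.I → ∀ r : ℕ → 𝓜(ℂ, C),
      (∀ n, ‖r n‖ ≤ 1) → (∀ n, r n * (a n + z • 1) = 1) →
      ∀ y, Tendsto (fun n => (r n).fst y) atTop (𝓝 ((resolvent E z).fst y)) := by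
    intro z hz r hr1 hr y
    refine tendsto_fst_of_dense hr1 (h𝒞.dense_range_add_smul hE hz) ?_ y
    rintro _ ⟨u, hu, rfl⟩
    rw [(isResolvent_resolvent hE hz).left_inv u]
    -- The second resolvent identity applied to `(E + z)u`; it leaves only the error `(a n - E)u`,
    -- which tends to zero on the core.
    have e : ∀ n, (r n).fst (E u + z • (u : C)) = u - (r n).fst ((a n).fst u - E u) := by
      intro n
      have h1 : (r n).fst ((a n).fst u + z • (u : C)) = u :=
        congrArg (fun m : 𝓜(ℂ, C) => m.fst (u : C)) (hr n)
      conv_rhs => enter [1]; rw [← h1]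
      rw [← map_sub]
      congr 1
      abel
    simp only [e]
    have h2 : Tendsto (fun n => (r n).fst ((a n).fst u - E u)) atTop (𝓝 0) := by
      refine squeeze_zero_norm (fun n => (norm_fst_apply_le _ _).trans ?_)
        (tendsto_iff_norm_sub_tendsto_zero.1 (h u hu))
      exact mul_le_of_le_one_left (norm_nonneg _) (hr1 n)
    simpa using tendsto_const_nhds.sub h2
  have key := tendsto_cfc_fst isCompact_resolventCircle (r := fun n => boundedResolvent (a n))
    (s := resolvent E Complex.I) (fun n => cfc_predicate _ _) (isStarNormal_resolvent hE)
    (fun n => spectrum_boundedResolvent_subset (ha n)) (spectrum_resolvent_subset hE)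
    (main _ (Or.inl rfl) _ (fun n => norm_boundedResolvent_le (ha n))
      fun n => boundedResolvent_mul (ha n))
    (by
      rw [star_resolvent hE]
      exact main _ (Or.inr rfl) _ (fun n => by
        rw [norm_star]; exact norm_boundedResolvent_le (ha n))
        fun n => star_boundedResolvent_mul (ha n)) hf x
  simp only [fun n => cfc_boundedResolvent (ha n) hf] at key
  exact key

end Core

/-! ### The bounded transform `i_N(D)` and the operator `(1 + N⁻²D²)⁻¹`. -/

section BoundedTransform

/-- With `w = (x + i)⁻¹` the hypothesis reads `(x + i)F = J + iF`, that is `J = xF`; so `D F(D) =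
J(D)`, and `F(D) D = J(D)` on the domain. `J` need not vanish at `w = 0`, which admits `x i_N(x)`
with its limit `N²` at infinity. -/
theorem cfc_resolvent_fst {D : C →ₗ.[ℂ] C} (hD : IsSelfAdjointMultiplier D) {F J : ℂ → ℂ}
    (hF : ContinuousOn F resolventCircle) (hJ : ContinuousOn J resolventCircle)
    (h : ∀ w ∈ resolventCircle, F w = w * (J w + Complex.I * F w)) :
    (∀ c, ∃ hc : (cfc F (resolvent D Complex.I)).fst c ∈ D.domain,
      D ⟨_, hc⟩ = (cfc J (resolvent D Complex.I)).fst c) ∧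
    ∀ x : D.domain, (cfc F (resolvent D Complex.I)).fst (D x)
      = (cfc J (resolvent D Complex.I)).fst x := by
  have hn := isStarNormal_resolvent hD
  have hs := spectrum_resolvent_subset hD
  have hR := isResolvent_resolvent hD (Or.inl rfl)
  set R := resolvent D Complex.I
  have hF' := hF.mono hs
  have hJ' := hJ.mono hs
  have hH : cfc (fun w => J w + Complex.I * F w) R = cfc J R + Complex.I • cfc F R := by
    rw [cfc_add R J (fun w => Complex.I * F w) hJ' (by fun_prop), cfc_const_mul _ _ R hF']
  have hHc : ContinuousOn (fun w => J w + Complex.I * F w) (spectrum ℂ R) := by fun_prop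
  have h1 : cfc F R = R * (cfc J R + Complex.I • cfc F R) := by
    rw [← hH]
    conv_rhs => enter [1]; rw [← cfc_id' ℂ R]
    rw [← cfc_mul _ _ R (by fun_prop) hHc]
    exact cfc_congr fun w hw => h w (hs hw)
  have h2 : cfc F R = (cfc J R + Complex.I • cfc F R) * R := by
    rw [← hH]
    conv_rhs => enter [2]; rw [← cfc_id' ℂ R]
    rw [← cfc_mul _ _ R hHc (by fun_prop)]
    exact cfc_congr fun w hw => (h w (hs hw)).trans (mul_comm _ _)
  constructor
  · intro c
    obtain ⟨hu, hu'⟩ := hR.right_inv ((cfc J R + Complex.I • cfc F R).fst c)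
    have e : R.fst ((cfc J R + Complex.I • cfc F R).fst c) = (cfc F R).fst c :=
      (congrArg (fun m : 𝓜(ℂ, C) => m.fst c) h1).symm
    simp only [e] at hu hu'
    exact ⟨hu, add_right_cancel hu'⟩
  · intro x
    have e : (cfc F R).fst (D x + Complex.I • (x : C))
        = (cfc J R).fst x + Complex.I • (cfc F R).fst x := by
      have e1 := congrArg (fun m : 𝓜(ℂ, C) => m.fst (D x + Complex.I • (x : C))) h2
      refine e1.trans ?_
      change (cfc J R + Complex.I • cfc F R).fst (R.fst (D x + Complex.I • (x : C))) = _
      rw [hR.left_inv x]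
      rfl
    rw [map_add, map_smul] at e
    exact add_right_cancel e

/-- The function `x ↦ (1 + N⁻² x²)⁻¹`. -/
noncomputable def gFun (N : ℝ) : ℝ → ℂ := fun x => (((1 + N⁻¹ ^ 2 * x ^ 2)⁻¹ : ℝ) : ℂ)

theorem continuousOn_circleFun_of_norm_le {f : ℝ → ℂ} (hf : Continuous f) {K : ℝ}
    (h : ∀ x, ‖f x‖ * |x| ≤ K) : ContinuousOn (circleFun f) resolventCircle := by
  refine continuousOn_circleFun ⟨⟨f, hf⟩, ?_⟩
  have h1 := ((tendsto_inv_atTop_zero (𝕜 := ℝ)).comp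
    (tendsto_norm_cocompact_atTop (E := ℝ))).const_mul K
  rw [mul_zero] at h1
  refine squeeze_zero_norm' ?_ h1
  filter_upwards [(isCompact_singleton (x := (0 : ℝ))).compl_mem_cocompact] with x hx
  exact (le_mul_inv_iff₀ (norm_pos_iff.2 hx)).2 (h x)

theorem norm_gFun (N x : ℝ) : ‖gFun N x‖ = (1 + N⁻¹ ^ 2 * x ^ 2)⁻¹ := by
  have h : 0 ≤ N⁻¹ ^ 2 * x ^ 2 := by positivity
  rw [gFun, Complex.norm_real, Real.norm_of_nonneg (by positivity)]

theorem norm_iFun (N x : ℝ) : ‖iFun N x‖ = |x| * (1 + N⁻¹ ^ 2 * x ^ 2)⁻¹ := by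
  have h : 0 ≤ N⁻¹ ^ 2 * x ^ 2 := by positivity
  rw [iFun, Complex.norm_real, norm_mul, Real.norm_eq_abs, Real.norm_of_nonneg (by positivity)]

theorem abs_le_mul_one_add {N : ℝ} (hN : 0 < N) (x : ℝ) : |x| ≤ N * (1 + N⁻¹ ^ 2 * x ^ 2) := by
  have h : |x| = N * (N⁻¹ * |x|) := by field_simp
  rw [h, ← sq_abs x]
  gcongr
  nlinarith [sq_nonneg (N⁻¹ * |x| - 1), sq_nonneg (N⁻¹ * |x|)]

theorem sq_le_mul_one_add {N : ℝ} (hN : 0 < N) (x : ℝ) :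
    x ^ 2 ≤ N ^ 2 * (1 + N⁻¹ ^ 2 * x ^ 2) := by
  have h : N ^ 2 * (1 + N⁻¹ ^ 2 * x ^ 2) = N ^ 2 + x ^ 2 := by field_simp
  rw [h]
  linarith [sq_nonneg N]

theorem norm_gFun_le (N x : ℝ) : ‖gFun N x‖ ≤ 1 := by
  have h : 0 ≤ N⁻¹ ^ 2 * x ^ 2 := by positivity
  rw [norm_gFun]
  exact inv_le_one_of_one_le₀ (by linarith)

theorem norm_iFun_le {N : ℝ} (hN : 0 < N) (x : ℝ) : ‖iFun N x‖ ≤ N := by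
  have h : 0 ≤ N⁻¹ ^ 2 * x ^ 2 := by positivity
  rw [norm_iFun, mul_inv_le_iff₀ (by positivity)]
  exact abs_le_mul_one_add hN x

theorem continuous_gFun (N : ℝ) : Continuous (gFun N) := by
  refine Complex.continuous_ofReal.comp (Continuous.inv₀ (by fun_prop) fun x => ?_)
  have h : 0 ≤ N⁻¹ ^ 2 * x ^ 2 := by positivity
  positivity

theorem continuous_iFun (N : ℝ) : Continuous (iFun N) := by
  refine Complex.continuous_ofReal.comp
    (continuous_id.mul (Continuous.inv₀ (by fun_prop) fun x => ?_))
  have h : 0 ≤ N⁻¹ ^ 2 * x ^ 2 := by positivity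
  positivity

theorem continuousOn_circleFun_gFun {N : ℝ} (hN : 0 < N) :
    ContinuousOn (circleFun (gFun N)) resolventCircle := by
  refine continuousOn_circleFun_of_norm_le (continuous_gFun N) (K := N) fun x => ?_
  have h : 0 ≤ N⁻¹ ^ 2 * x ^ 2 := by positivity
  rw [norm_gFun, inv_mul_le_iff₀ (by positivity), mul_comm]
  exact abs_le_mul_one_add hN x

theorem continuousOn_circleFun_iFun {N : ℝ} (hN : 0 < N) :
    ContinuousOn (circleFun (iFun N)) resolventCircle := by
  refine continuousOn_circleFun_of_norm_le (continuous_iFun N) (K := N ^ 2) fun x => ?_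
  have h : 0 ≤ N⁻¹ ^ 2 * x ^ 2 := by positivity
  rw [norm_iFun, mul_right_comm, mul_inv_le_iff₀ (by positivity), abs_mul_abs_self, ← sq]
  exact sq_le_mul_one_add hN x

theorem norm_circleFun_le {f : ℝ → ℂ} {K : ℝ} (h : ∀ x, ‖f x‖ ≤ K) (w : ℂ) :
    ‖circleFun f w‖ ≤ K := by
  rw [circleFun]
  split_ifs
  · simpa using (norm_nonneg _).trans (h 0)
  · exact h _

theorem norm_funcCalc_le (D : C →ₗ.[ℂ] C) {f : ℝ → ℂ} {K : ℝ} (h : ∀ x, ‖f x‖ ≤ K) :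
    ‖funcCalc D f‖ ≤ K :=
  norm_cfc_le ((norm_nonneg _).trans (h 0)) fun w _ => norm_circleFun_le h w

theorem isSelfAdjoint_funcCalc_iFun (D : C →ₗ.[ℂ] C) (N : ℝ) :
    IsSelfAdjoint (funcCalc D (iFun N)) := by
  rw [isSelfAdjoint_iff, funcCalc, ← cfc_star]
  refine cfc_congr fun w _ => ?_
  split_ifs
  · simp
  · exact Complex.conj_ofReal _

theorem inv_eq_re_add_I {w : ℂ} (hw : w ∈ resolventCircle) (hw0 : w ≠ 0) :
    w⁻¹ = ((w⁻¹).re : ℂ) + Complex.I := by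
  apply Complex.ext
  · simp [-Complex.inv_re]
  · simp [-Complex.inv_im, im_inv_of_mem_resolventCircle hw hw0]

theorem funcCalc_gFun_fst {D : C →ₗ.[ℂ] C} (hD : IsSelfAdjointMultiplier D) {N : ℝ}
    (hN : 0 < N) :
    (∀ c, ∃ hc : (funcCalc D (gFun N)).fst c ∈ D.domain,
      D ⟨_, hc⟩ = (funcCalc D (iFun N)).fst c) ∧
    ∀ x : D.domain, (funcCalc D (gFun N)).fst (D x) = (funcCalc D (iFun N)).fst x := by
  refine cfc_resolvent_fst (F := circleFun (gFun N)) (J := circleFun (iFun N)) hD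
    (continuousOn_circleFun_gFun hN) (continuousOn_circleFun_iFun hN) fun w hw => ?_
  by_cases hw0 : w = 0
  · simp [hw0, circleFun]
  rw [circleFun, circleFun, if_neg hw0, if_neg hw0]
  have h : iFun N (w⁻¹).re + Complex.I * gFun N (w⁻¹).re = w⁻¹ * gFun N (w⁻¹).re := by
    rw [inv_eq_re_add_I hw hw0]
    simp only [iFun, gFun]
    push_cast
    simp
    ring
  rw [h, mul_inv_cancel_left₀ hw0]

theorem funcCalc_iFun_fst {D : C →ₗ.[ℂ] C} (hD : IsSelfAdjointMultiplier D) {N : ℝ}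
    (hN : 0 < N) :
    (∀ c, ∃ hc : (funcCalc D (iFun N)).fst c ∈ D.domain,
      D ⟨_, hc⟩ = ((N : ℂ) ^ 2) • (c - (funcCalc D (gFun N)).fst c)) ∧
    ∀ x : D.domain, (funcCalc D (iFun N)).fst (D x)
      = ((N : ℂ) ^ 2) • ((x : C) - (funcCalc D (gFun N)).fst x) := by
  have hg := continuousOn_circleFun_gFun hN
  have hn := isStarNormal_resolvent hD
  have hg' := hg.mono (spectrum_resolvent_subset hD)
  have hJ : cfc (fun w => (N : ℂ) ^ 2 * (1 - circleFun (gFun N) w)) (resolvent D Complex.I)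
      = ((N : ℂ) ^ 2) • (1 - funcCalc D (gFun N)) := by
    rw [cfc_const_mul _ _ _ (by fun_prop), cfc_sub _ _ _ (by fun_prop) hg',
      cfc_const_one ℂ (resolvent D Complex.I)]
    rfl
  have h := cfc_resolvent_fst hD (continuousOn_circleFun_iFun hN)
    (J := fun w => (N : ℂ) ^ 2 * (1 - circleFun (gFun N) w)) (by fun_prop) fun w hw => ?_
  · rw [hJ] at h
    exact h
  by_cases hw0 : w = 0
  · simp [hw0, circleFun]
  rw [circleFun, circleFun, if_neg hw0, if_neg hw0]
  have h : (N : ℂ) ^ 2 * (1 - gFun N (w⁻¹).re) + Complex.I * iFun N (w⁻¹).re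
      = w⁻¹ * iFun N (w⁻¹).re := by
    have h1 : ∀ x : ℝ, N ^ 2 * (1 - (1 + N⁻¹ ^ 2 * x ^ 2)⁻¹) = x * (x * (1 + N⁻¹ ^ 2 * x ^ 2)⁻¹) := by
      intro x
      have h2 : 0 ≤ N⁻¹ ^ 2 * x ^ 2 := by positivity
      have h3 : 1 + N⁻¹ ^ 2 * x ^ 2 ≠ 0 := by positivity
      have h4 : 1 - (1 + N⁻¹ ^ 2 * x ^ 2)⁻¹
          = (N⁻¹ ^ 2 * x ^ 2) * (1 + N⁻¹ ^ 2 * x ^ 2)⁻¹ := by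
        rw [eq_mul_inv_iff_mul_eq₀ h3, sub_mul, inv_mul_cancel₀ h3]
        ring
      rw [h4]
      have h5 : N ^ 2 * N⁻¹ ^ 2 = 1 := by rw [← mul_pow, mul_inv_cancel₀ hN.ne', one_pow]
      linear_combination (x ^ 2 * (1 + N⁻¹ ^ 2 * x ^ 2)⁻¹) * h5
    have h6 := congrArg (fun x : ℝ => (x : ℂ)) (h1 (w⁻¹).re)
    rw [inv_eq_re_add_I hw hw0]
    simp only [iFun, gFun]
    simp only [Complex.add_re, Complex.ofReal_re, Complex.I_re, add_zero]
    push_cast at h6 ⊢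
    linear_combination h6
  rw [h, mul_inv_cancel_left₀ hw0]

end BoundedTransform

/-! ### Uniform commutator bounds and convergence on the invariant core. -/

section Core

/-- The operators induced by `D`, `(1 + N⁻² D²)⁻¹` and `i_N(D)` on a subspace invariant under
`i_N(D)` on which the resolvents of `D` are bijective. -/
theorem exists_end_of_bijOn {D : C →ₗ.[ℂ] C} (hD : IsSelfAdjointMultiplier D) {𝒞 : Submodule ℂ C}
    (hmaps : ∀ N : ℝ, 0 < N → Set.MapsTo (funcCalc D (iFun N)).fst 𝒞 𝒞)
    (hbij : Set.BijOn (resolvent D Complex.I).fst 𝒞 𝒞) :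
    ∃ d : Module.End ℂ 𝒞, (∀ x : 𝒞, ∃ h : (x : C) ∈ D.domain, D ⟨x, h⟩ = d x) ∧
      ∀ N : ℝ, 0 < N → ∃ g n : Module.End ℂ 𝒞,
        (∀ x : 𝒞, (n x : C) = (funcCalc D (iFun N)).fst x) ∧
        (∀ x : 𝒞, ‖(g x : C)‖ ≤ ‖(x : C)‖) ∧ (∀ x : 𝒞, ‖(n x : C)‖ ≤ N * ‖(x : C)‖) ∧
        d * g = n ∧ g * d = n ∧ d * n = ((N : ℂ) ^ 2) • (1 - g) ∧
        n * d = ((N : ℂ) ^ 2) • (1 - g) := by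
  have hR := isResolvent_resolvent hD (Or.inl rfl)
  -- Every `x` in `𝒞` is `(D + i)⁻¹y` with `y` in `𝒞`, and then `Dx = y - ix`.
  have hdom : ∀ x ∈ 𝒞, ∃ h : x ∈ D.domain, D ⟨x, h⟩ ∈ 𝒞 := by
    intro x hx
    obtain ⟨y, hy, rfl⟩ := hbij.surjOn hx
    obtain ⟨hu, hu'⟩ := hR.right_inv y
    refine ⟨hu, ?_⟩
    rw [eq_sub_of_add_eq hu']
    exact 𝒞.sub_mem hy (𝒞.smul_mem _ hx)
  have hle : 𝒞 ≤ D.domain := fun x hx => (hdom x hx).1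
  let d : Module.End ℂ 𝒞 :=
    (D.toFun.comp (Submodule.inclusion hle)).codRestrict 𝒞 fun x => (hdom x x.2).2
  have hd : ∀ x : 𝒞, D ⟨x, hle x.2⟩ = d x := fun x => rfl
  refine ⟨d, fun x => ⟨hle x.2, rfl⟩, fun N hN => ?_⟩
  obtain ⟨hg1, hg2⟩ := funcCalc_gFun_fst hD hN
  obtain ⟨hi1, hi2⟩ := funcCalc_iFun_fst hD hN
  have hN0 : (N : ℂ) ^ 2 ≠ 0 := pow_ne_zero 2 (Complex.ofReal_ne_zero.2 hN.ne')
  let n : Module.End ℂ 𝒞 :=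
    ((funcCalc D (iFun N)).fst : C →ₗ[ℂ] C).restrict (hmaps N hN)
  have hn : ∀ x : 𝒞, (n x : C) = (funcCalc D (iFun N)).fst x := fun x => rfl
  -- Invariance under `D` and `i_N(D)` suffices, because `D i_N(D) = N²(1 - g)`.
  have hgm : Set.MapsTo (funcCalc D (gFun N)).fst 𝒞 𝒞 := by
    intro x hx
    obtain ⟨h, h'⟩ := hi1 x
    have h1 : D ⟨_, h⟩ ∈ 𝒞 := (hdom _ (hmaps N hN hx)).2
    rw [h', 𝒞.smul_mem_iff hN0] at h1
    have h2 := 𝒞.sub_mem hx h1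
    rwa [sub_sub_cancel] at h2
  let g : Module.End ℂ 𝒞 :=
    ((funcCalc D (gFun N)).fst : C →ₗ[ℂ] C).restrict hgm
  have hg : ∀ x : 𝒞, (g x : C) = (funcCalc D (gFun N)).fst x := fun x => rfl
  refine ⟨g, n, hn, fun x => ?_, fun x => ?_, ?_, ?_, ?_, ?_⟩
  · rw [hg]
    refine (norm_fst_apply_le _ _).trans (mul_le_of_le_one_left (norm_nonneg _) ?_)
    exact norm_funcCalc_le D (norm_gFun_le N)
  · rw [hn]
    refine (norm_fst_apply_le _ _).trans ?_
    gcongr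
    exact norm_funcCalc_le D (norm_iFun_le hN)
  · exact LinearMap.ext fun x => Subtype.ext (hg1 x).2
  · exact LinearMap.ext fun x => Subtype.ext (hg2 ⟨x, hle x.2⟩)
  · exact LinearMap.ext fun x => Subtype.ext (hi1 x).2
  · exact LinearMap.ext fun x => Subtype.ext (hi2 ⟨x, hle x.2⟩)

/-- Writing `n = dg = gd`, the first term on the right is `nXg + gXn`. As `s⁻¹nd = s⁻¹dn = 1 - g`,
the second is `(1 - g)Xn + nX(1 - g)`, and the sum is `nX + Xn`. Only bounded operators surround `dX
+ Xd`. -/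
theorem anticommutator_eq {R : Type*} [Ring R] [Algebra ℂ R] {d g n X : R} {s : ℂ} (hs : s ≠ 0)
    (hdg : d * g = n) (hgd : g * d = n) (hdn : d * n = s • (1 - g)) (hnd : n * d = s • (1 - g)) :
    n * X + X * n = g * (d * X + X * d) * g + s⁻¹ • (n * (d * X + X * d) * n) := by
  have h1 : g * (d * X + X * d) * g = n * X * g + g * X * n := by
    rw [← hgd]
    conv_rhs => enter [2]; rw [hgd, ← hdg]
    noncomm_ring
  have h2 : n * (d * X + X * d) * n = s • ((1 - g) * X * n + n * X * (1 - g)) := by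
    have e : n * (d * X + X * d) * n = (n * d) * X * n + n * X * (d * n) := by noncomm_ring
    rw [e, hnd, hdn, smul_add, smul_mul_assoc, smul_mul_assoc, mul_smul_comm]
  rw [h1, h2, smul_smul, inv_mul_cancel₀ hs, one_smul]
  noncomm_ring

/-- Passing from `D` to `i_N(D)` at most doubles the norm of a graded commutator. -/
theorem norm_anticommutator_apply_le {𝒞 : Submodule ℂ C} {d g n X : Module.End ℂ 𝒞} {N M : ℝ}
    (hN : 0 < N) (hg : ∀ x : 𝒞, ‖(g x : C)‖ ≤ ‖(x : C)‖)
    (hn : ∀ x : 𝒞, ‖(n x : C)‖ ≤ N * ‖(x : C)‖)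
    (hdg : d * g = n) (hgd : g * d = n) (hdn : d * n = ((N : ℂ) ^ 2) • (1 - g))
    (hnd : n * d = ((N : ℂ) ^ 2) • (1 - g)) (hM : 0 ≤ M)
    (hX : ∀ x : 𝒞, ‖((d * X + X * d) x : C)‖ ≤ M * ‖(x : C)‖) (x : 𝒞) :
    ‖((n * X + X * n) x : C)‖ ≤ 2 * M * ‖(x : C)‖ := by
  have hN0 : (N : ℂ) ^ 2 ≠ 0 := pow_ne_zero 2 (Complex.ofReal_ne_zero.2 hN.ne')
  rw [anticommutator_eq hN0 hdg hgd hdn hnd]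
  set T := d * X + X * d
  have h1 : ‖(g (T (g x)) : C)‖ ≤ M * ‖(x : C)‖ :=
    (hg _).trans ((hX _).trans (mul_le_mul_of_nonneg_left (hg x) hM))
  have h2 : ‖((N : ℂ) ^ 2)⁻¹ • (n (T (n x)) : C)‖ ≤ M * ‖(x : C)‖ := by
    rw [norm_smul, norm_inv, norm_pow, Complex.norm_real, Real.norm_of_nonneg hN.le,
      inv_mul_le_iff₀ (by positivity)]
    calc _ ≤ N * ‖(T (n x) : C)‖ := hn _
      _ ≤ N * (M * (N * ‖(x : C)‖)) := by
        gcongr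
        exact (hX _).trans (mul_le_mul_of_nonneg_left (hn x) hM)
      _ = _ := by ring
  calc _ ≤ ‖(g (T (g x)) : C)‖ + ‖((N : ℂ) ^ 2)⁻¹ • (n (T (n x)) : C)‖ := norm_add_le _ _
    _ ≤ _ := by linarith

end Core

/-- The bounded transforms `i_n(D)` and `i_n(D')` have uniformly bounded graded commutators. -/
theorem HasBoundedCommutatorOn.exists_norm_anticommutator_le {D D' : C →ₗ.[ℂ] C}
    {𝒞 : Submodule ℂ C} (hD : IsSelfAdjointMultiplier D) (hD' : IsSelfAdjointMultiplier D')
    (h : HasBoundedCommutatorOn D D' 𝒞) :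
    ∃ M : ℝ, 0 ≤ M ∧ ∀ N : ℝ, 0 < N →
      ‖funcCalc D (iFun N) * funcCalc D' (iFun N) + funcCalc D' (iFun N) * funcCalc D (iFun N)‖
        ≤ M := by
  obtain ⟨T, hT⟩ := h.commutator
  obtain ⟨d, hd, hdN⟩ := exists_end_of_bijOn hD h.mapsTo_left (h.bijOn_left _ (Or.inl rfl))
  obtain ⟨d', hd', hdN'⟩ := exists_end_of_bijOn hD' h.mapsTo_right (h.bijOn_right _ (Or.inl rfl))
  have hdd : ∀ x : 𝒞, ‖((d * d' + d' * d) x : C)‖ ≤ ‖T‖ * ‖(x : C)‖ := by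
    intro x
    obtain ⟨hx, hx', h1, h2, h3⟩ := hT x x.2
    have e : ((d * d' + d' * d) x : C) = T x := by
      rw [← h3]
      change (d (d' x) : C) + d' (d x) = _
      congr 1
      · obtain ⟨_, e1⟩ := hd' x
        obtain ⟨_, e2⟩ := hd (d' x)
        rw [← e2]
        congr 1
        exact Subtype.ext e1.symm
      · obtain ⟨_, e1⟩ := hd x
        obtain ⟨_, e2⟩ := hd' (d x)
        rw [← e2]
        congr 1
        exact Subtype.ext e1.symm
    rw [e]
    exact T.le_opNorm x
  refine ⟨2 * (2 * ‖T‖), by positivity, fun N hN => ?_⟩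
  obtain ⟨g, n, hn, hgle, hnle, e1, e2, e3, e4⟩ := hdN N hN
  obtain ⟨g', n', hn', hgle', hnle', e1', e2', e3', e4'⟩ := hdN' N hN
  -- Two passes, first replacing `D` by `D_N` with `X = D'`, then `D'` by `D'_N` with `X = D_N`;
  -- each doubles the bound, whence `4‖T‖`.
  have k1 := norm_anticommutator_apply_le hN hgle hnle e1 e2 e3 e4 (norm_nonneg T) hdd
  have k2 := norm_anticommutator_apply_le (X := n) hN hgle' hnle' e1' e2' e3' e4'
    (M := 2 * ‖T‖) (by positivity) fun x => by rw [add_comm]; exact k1 x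
  refine norm_le_of_fst_apply_le (by positivity) fun x => ?_
  have hcl : IsClosed {x : C | ‖(funcCalc D (iFun N) * funcCalc D' (iFun N)
      + funcCalc D' (iFun N) * funcCalc D (iFun N)).fst x‖ ≤ 2 * (2 * ‖T‖) * ‖x‖} :=
    isClosed_le (ContinuousLinearMap.continuous _).norm (by fun_prop)
  refine hcl.closure_subset_iff.2 ?_ (h.core_left.dense x)
  intro y hy
  have k3 := k2 ⟨y, hy⟩
  have e : ((n' * n + n * n') ⟨y, hy⟩ : C) = (funcCalc D (iFun N) * funcCalc D' (iFun N)
      + funcCalc D' (iFun N) * funcCalc D (iFun N)).fst y := by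
    change (n' (n ⟨y, hy⟩) : C) + n (n' ⟨y, hy⟩)
      = (funcCalc D (iFun N)).fst ((funcCalc D' (iFun N)).fst y)
        + (funcCalc D' (iFun N)).fst ((funcCalc D (iFun N)).fst y)
    rw [hn', hn, hn, hn', add_comm]
  rw [e] at k3
  exact k3

/-- The bounded transforms `i_n(D)` converge to `D` on an invariant subspace. -/
theorem tendsto_funcCalc_iFun {D : C →ₗ.[ℂ] C} (hD : IsSelfAdjointMultiplier D)
    {𝒞 : Submodule ℂ C}
    (hmaps : ∀ N : ℝ, 0 < N → Set.MapsTo (funcCalc D (iFun N)).fst 𝒞 𝒞)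
    (hbij : Set.BijOn (resolvent D Complex.I).fst 𝒞 𝒞) (x : D.domain) (hx : (x : C) ∈ 𝒞) :
    Tendsto (fun n : ℕ => (funcCalc D (iFun ((n : ℝ) + 1))).fst x) atTop (𝓝 (D x)) := by
  obtain ⟨d, hd, hdN⟩ := exists_end_of_bijOn hD hmaps hbij
  rw [tendsto_iff_norm_sub_tendsto_zero]
  have h1 := tendsto_one_div_add_atTop_nhds_zero_nat (𝕜 := ℝ) |>.mul_const ‖(d (d ⟨x, hx⟩) : C)‖
  rw [zero_mul] at h1
  refine squeeze_zero (fun _ => norm_nonneg _) (fun k => ?_) h1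
  have hN : (0 : ℝ) < (k : ℝ) + 1 := by positivity
  set N := (k : ℝ) + 1
  have hN0 : (N : ℂ) ^ 2 ≠ 0 := pow_ne_zero 2 (Complex.ofReal_ne_zero.2 hN.ne')
  obtain ⟨g, n, hn, -, hnle, -, e2, -, e4⟩ := hdN N hN
  -- Thus `D - D_N = N⁻² D_N D²` on `𝒞`. Since `‖D_N‖ ≤ N`, the error at `x` is at most `N⁻¹‖D²x‖`.
  have e5 : n * d * d = ((N : ℂ) ^ 2) • (d - n) := by
    rw [e4, smul_mul_assoc, sub_mul, one_mul, e2]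
  obtain ⟨_, e6⟩ := hd ⟨x, hx⟩
  have e7 : (funcCalc D (iFun N)).fst x - D x = -(((N : ℂ) ^ 2)⁻¹ • (n (d (d ⟨x, hx⟩)) : C)) := by
    have e8 : (n (d (d ⟨x, hx⟩)) : C) = ((N : ℂ) ^ 2) • ((d ⟨x, hx⟩ : C) - n ⟨x, hx⟩) :=
      congrArg (fun m : Module.End ℂ 𝒞 => (m ⟨x, hx⟩ : C)) e5
    rw [e8, smul_smul, inv_mul_cancel₀ hN0, one_smul, neg_sub, hn, ← e6]
  rw [e7, norm_neg, norm_smul, norm_inv, norm_pow, Complex.norm_real, Real.norm_of_nonneg hN.le,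
    inv_mul_le_iff₀ (by positivity)]
  refine (hnle _).trans_eq ?_
  field_simp

/-! ### Passage to the limit `N → ∞`. -/

/-- Quantitative comparison of the functional calculi of `D`, `D'` and `D + D'`. -/
theorem HasBoundedCommutatorOn.exists_norm_sub_le {D D' : C →ₗ.[ℂ] C}
    {𝒞 : Submodule ℂ C} (hD : IsSelfAdjointMultiplier D) (hD' : IsSelfAdjointMultiplier D')
    (h : HasBoundedCommutatorOn D D' 𝒞) :
    ∃ M : ℝ, 0 ≤ M ∧ ∀ t : ℝ, 0 < t → (t⁻¹) ^ 2 * M ≤ 1 →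
      ‖funcCalc (closedSum D D') (gaussian t)
          - funcCalc D (gaussian t) * funcCalc D' (gaussian t)‖ ≤ 100 * (t⁻¹ ^ 2 * M) ∧
      ‖funcCalc (closedSum D D') (xGaussian t)
          - funcCalc D (xGaussian t) * funcCalc D' (gaussian t)
          - funcCalc D (gaussian t) * funcCalc D' (xGaussian t)‖ ≤ 1500 * (t⁻¹ ^ 2 * M) := by
  obtain ⟨M, hM0, hM⟩ := h.exists_norm_anticommutator_le hD hD'
  refine ⟨M, hM0, fun t ht htM => ?_⟩
  have hE : IsSelfAdjointMultiplier (closedSum D D') := h.sum_essSelfAdjoint.closure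
  let a : ℕ → 𝓜(ℂ, C) := fun n => funcCalc D (iFun ((n : ℝ) + 1))
  let b : ℕ → 𝓜(ℂ, C) := fun n => funcCalc D' (iFun ((n : ℝ) + 1))
  have ha : ∀ n, IsSelfAdjoint (a n) := fun n => isSelfAdjoint_funcCalc_iFun D _
  have hb : ∀ n, IsSelfAdjoint (b n) := fun n => isSelfAdjoint_funcCalc_iFun D' _
  have hab : ∀ n, IsSelfAdjoint (a n + b n) := fun n => (ha n).add (hb n)
  have la := tendsto_funcCalc_iFun hD h.mapsTo_left (h.bijOn_left _ (Or.inl rfl))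
  have lb := tendsto_funcCalc_iFun hD' h.mapsTo_right (h.bijOn_right _ (Or.inl rfl))
  have lab : ∀ x : (closedSum D D').domain, (x : C) ∈ 𝒞 →
      Tendsto (fun n => (a n + b n).fst x) atTop (𝓝 (closedSum D D' x)) := by
    intro x hx
    have hx1 := h.core_left.hasCore.le_domain hx
    have hx2 := h.core_right.hasCore.le_domain hx
    have e : closedSum D D' x = D ⟨x, hx1⟩ + D' ⟨x, hx2⟩ :=
      ((LinearPMap.le_closure (D + D')).2
        (x := (⟨x, hx1, hx2⟩ : (D + D').domain)) (y := x) rfl).symm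
    rw [e]
    exact (la ⟨x, hx1⟩ hx).add (lb ⟨x, hx2⟩ hx)
  have hG := continuousOn_circleFun_gaussian ht
  have hX := continuousOn_circleFun_xGaussian ht
  have sα : ∀ n, IsSelfAdjoint (t⁻¹ • a n) := fun n => (IsSelfAdjoint.all _).smul (ha n)
  have sβ : ∀ n, IsSelfAdjoint (t⁻¹ • b n) := fun n => (IsSelfAdjoint.all _).smul (hb n)
  have hε : ∀ n, ‖(t⁻¹ • a n) * (t⁻¹ • b n) + (t⁻¹ • b n) * (t⁻¹ • a n)‖ ≤ t⁻¹ ^ 2 * M := by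
    intro n
    rw [smul_mul_smul_comm, smul_mul_smul_comm, ← smul_add, norm_smul,
      Real.norm_of_nonneg (by positivity), ← sq]
    gcongr
    exact hM _ (by positivity)
  have lGs := tendsto_funcCalc hE h.core_sum hab lab hG
  have lXs := tendsto_funcCalc hE h.core_sum hab lab hX
  have lGa := tendsto_funcCalc hD h.core_left ha la hG
  have lXa := tendsto_funcCalc hD h.core_left ha la hX
  have lGb := tendsto_funcCalc hD' h.core_right hb lb hG
  have lXb := tendsto_funcCalc hD' h.core_right hb lb hX
  simp only [cfc_gaussian_re, cfc_xGaussian_re, ha, hb, hab, smul_add] at lGs lXs lGa lXa lGb lXb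
  have nGa : ∀ n, ‖expNegSq (t⁻¹ • a n)‖ ≤ 1 := fun n => norm_expNegSq_le (sα n)
  have nXa : ∀ n, ‖(t⁻¹ • a n) * expNegSq (t⁻¹ • a n)‖ ≤ 1 := fun n =>
    norm_mul_expNegSq_le (sα n)
  constructor
  · refine norm_le_of_fst_apply_le (by positivity) fun x => ?_
    -- The approximants satisfy the bound uniformly in `n`, and it is tested on each vector `x`
    -- separately, so strong convergence is enough.
    refine le_of_tendsto ((lGs x).sub (tendsto_fst_apply nGa lGa (lGb x))).norm
      (Eventually.of_forall fun n => ?_)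
    refine (norm_fst_apply_le (expNegSq (t⁻¹ • a n + t⁻¹ • b n)
      - expNegSq (t⁻¹ • a n) * expNegSq (t⁻¹ • b n)) x).trans ?_
    gcongr
    exact (norm_expNegSq_add_sub_le (sα n) (sβ n) ((hε n).trans htM)).trans
      (mul_le_mul_of_nonneg_left (hε n) (by norm_num))
  · refine norm_le_of_fst_apply_le (by positivity) fun x => ?_
    refine le_of_tendsto (((lXs x).sub (tendsto_fst_apply nXa lXa (lGb x))).sub
      (tendsto_fst_apply nGa lGa (lXb x))).norm (Eventually.of_forall fun n => ?_)
    refine (norm_fst_apply_le ((t⁻¹ • a n + t⁻¹ • b n) * expNegSq (t⁻¹ • a n + t⁻¹ • b n)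
      - (t⁻¹ • a n) * expNegSq (t⁻¹ • a n) * expNegSq (t⁻¹ • b n)
      - expNegSq (t⁻¹ • a n) * ((t⁻¹ • b n) * expNegSq (t⁻¹ • b n))) x).trans ?_
    gcongr
    exact (norm_add_mul_expNegSq_sub_le (sα n) (sβ n) ((hε n).trans htM)).trans
      (mul_le_mul_of_nonneg_left (hε n) (by norm_num))

end UnboundedMultiplier

theorem mainTheorem6 {C : Type*} [NonUnitalCStarAlgebra C] (γ : C ≃⋆ₐ[ℂ] C)
    (hγ : Function.Involutive γ) (D D' : C →ₗ.[ℂ] C)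
    (hD : UnboundedMultiplier.IsEssSelfAdjointMultiplier D)
    (hD' : UnboundedMultiplier.IsEssSelfAdjointMultiplier D')
    (hodd : UnboundedMultiplier.IsOdd γ D) (hodd' : UnboundedMultiplier.IsOdd γ D')
    (hbc : UnboundedMultiplier.HasBoundedCommutator D D') :
    Tendsto (fun t : ℝ =>
      ‖UnboundedMultiplier.funcCalc (UnboundedMultiplier.closedSum D.closure D'.closure)
            (UnboundedMultiplier.gaussian t)
          - UnboundedMultiplier.funcCalc D.closure (UnboundedMultiplier.gaussian t)
            * UnboundedMultiplier.funcCalc D'.closure (UnboundedMultiplier.gaussian t)‖)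
      atTop (𝓝 0) ∧
    Tendsto (fun t : ℝ =>
      ‖UnboundedMultiplier.funcCalc (UnboundedMultiplier.closedSum D.closure D'.closure)
            (UnboundedMultiplier.xGaussian t)
          - UnboundedMultiplier.funcCalc D.closure (UnboundedMultiplier.xGaussian t)
            * UnboundedMultiplier.funcCalc D'.closure (UnboundedMultiplier.gaussian t)
          - UnboundedMultiplier.funcCalc D.closure (UnboundedMultiplier.gaussian t)
            * UnboundedMultiplier.funcCalc D'.closure (UnboundedMultiplier.xGaussian t)‖)
      atTop (𝓝 0) := by
  obtain ⟨𝒞, h⟩ := hbc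
  obtain ⟨M, -, hM⟩ := h.exists_norm_sub_le hD.closure hD'.closure
  have hlim : Tendsto (fun t : ℝ => t⁻¹ ^ 2 * M) atTop (𝓝 0) := by
    simpa using (tendsto_inv_atTop_zero.pow 2).mul_const M
  have hev : ∀ᶠ t : ℝ in atTop, 0 < t ∧ t⁻¹ ^ 2 * M ≤ 1 :=
    (eventually_gt_atTop 0).and (hlim.eventually_le_const one_pos)
  constructor
  · refine squeeze_zero' (Eventually.of_forall fun _ => norm_nonneg _) ?_
      (by simpa only [mul_zero] using hlim.const_mul 100)
    filter_upwards [hev] with t ht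
    exact (hM t ht.1 ht.2).1
  · refine squeeze_zero' (Eventually.of_forall fun _ => norm_nonneg _) ?_
      (by simpa only [mul_zero] using hlim.const_mul 1500)
    filter_upwards [hev] with t ht
    exact (hM t ht.1 ht.2).2
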